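/- **Setting.** Let $\mathcal H,\mathfrak H$ be complex separable Hilbert spaces with scalar products linear in the first argument, and let $A$ be a densely defined, closed, symmetric operator in $\mathcal H$ with equal deficiency indices. Equip $\mathcal H_+:=\operatorname{dom}(A^*)$ with the graph norm of $A^*$. Let $\mathcal D$ be a dense subspace of $\mathcal H_+$ with $\operatorname{dom}(A)\subset\mathcal D$, equipped with a Banach norm for which the embedding $\mathcal D\hookrightarrow\mathcal H_+$ is continuous. On $\mathfrak H\times\mathfrak H$ put $J(f_1,f_2)=(f_2,-f_1)$ and $\omega(f,g)=\langle Jf,g\rangle=\langle f_2,g_1\rangle-\langle f_1,g_2\rangle$; a subspace is *Lagrangian* if it equals its $\omega$-annihilator. For every $t\in[0,1]$ let the following be given: * $\mathrm T_t\in\mathcal B(\mathcal D,\mathfrak H\times\mathfrak H)$ with dense range and $\langle A^*u,v\rangle-\langle u,A^*v\rangle=\omega(\mathrm T_tu,\mathrm T_tv)$ for all $u,v\in\mathcal D$; * an orthogonal projection $Q_t$ in $\mathfrak H\times\mathfrak H$ whose range is Lagrangian; * a self-adjoint extension $\mathcal A_t$ of $A$ with $\operatorname{dom}(\mathcal A_t)\subset\mathcal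 D$ and $\overline{\mathrm T_t(\operatorname{dom}(\mathcal A_t))}=\operatorname{ran}(Q_t)$; * a bounded self-adjoint operator $V_t$ in $\mathcal H$. Put $H_t:=\mathcal A_t+V_t$. Fix $t_0\in[0,1]$; all limits and derivatives at $t_0$ are taken within $[0,1]$. Assume that $$\|(\mathcal A_t-\mathrm i)^{-1}-(\mathcal A_{t_0}-\mathrm i)^{-1}\|_{\mathcal B(\mathcal H,\mathcal D)}\to0\quad\text{as } t\to t_0,$$ and that $t\mapsto\mathrm T_t$, $t\mapsto V_t$, $t\mapsto Q_t$ are differentiable at $t_0$ in $\mathcal B(\mathcal D,\mathfrak H\times\mathfrak H)$, $\mathcal B(\mathcal H)$, $\mathcal B(\mathfrak H\times\mathfrak H)$, with derivatives $\dot{\mathrm T}_{t_0},\dot V_{t_0},\dot Q_{t_0}$. Let $\lambda$ be an isolated eigenvalue of $H_{t_0}$ of finite multiplicity $m\ge1$, let $r>0$ be such that the closed disc of radius $r$ about $\lambda$ meets $\operatorname{Spec}(H_{t_0})$ only in $\lambda$, let $B$ be the open disc of radius $r$ about $\lambda$, and let $$P:=-\frac1{2\pi\mathrm i}\oint_{|\zeta-\lambda|=r}(H_{t_0}-\zeta)^{-1}\,d\zeta\in\mathcal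 B(\mathcal H,\mathcal D)$$ be the Riesz projection. **Theorem.** One has $\operatorname{ran}(P)=\ker(H_{t_0}-\lambda)$. Put $$T^{(1)}:=P\dot V_{t_0}P-(\mathrm T_{t_0}P)^*\dot Q_{t_0}J\,\mathrm T_{t_0}P-(\mathrm T_{t_0}P)^*J\,\dot{\mathrm T}_{t_0}P .$$ There are an orthonormal basis $u_1,\dots,u_m$ of $\ker(H_{t_0}-\lambda)$ and real numbers $\lambda^{(1)}_1,\dots,\lambda_m^{(1)}$ with $T^{(1)}u_j=\lambda_j^{(1)}u_j$ for all $j$. For every such choice of $u_j$ and $\lambda_j^{(1)}$ there are real functions $\lambda_1(t),\dots,\lambda_m(t)$ such that, for all $t\in[0,1]$ sufficiently near $t_0$, the spectrum of $H_t$ in $B$ consists of eigenvalues, and these are exactly $\lambda_1(t),\dots,\lambda_m(t)$, repeated according to multiplicity; and for every $1\le j\le m$ $$\lambda_j(t)=\lambda+\lambda_j^{(1)}(t-t_0)+o(t-t_0)\quad\text{as }t\to t_0,$$ $\lambda_j$ is differentiable at $t_0$, and $$\dot\lambda_j(t_0)=\langle\dot V_{t_0}u_j,u_j\rangle+\omega(\dot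 Q_{t_0}\mathrm T_{t_0}u_j,\mathrm T_{t_0}u_j)+\omega(\mathrm T_{t_0}u_j,\dot{\mathrm T}_{t_0}u_j).$$ -/

import Mathlib

noncomputable section

namespace Hadamard

/-- Differentiability at `t₀`, relative to the parameter interval `[0, 1]` (so one-sided at the
endpoints), of a family in a complex normed space, such as a space of bounded operators. -/
def HasParamDeriv {X : Type*} [NormedAddCommGroup X] [NormedSpace ℂ X]
    (F : ℝ → X) (dF : X) (t₀ : ℝ) : Prop :=
  HasDerivWithinAt F dF (Set.Icc 0 1) t₀

/-! ### Unbounded operators: eigenspaces, resolvents, spectrum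

Unbounded operators are `LinearPMap`s. Mathlib's inner product is linear in the second argument,
so the scalar product `⟨f, g⟩` that is linear in the first argument is `inner ℂ g f`. -/

section Operators

variable {H : Type*} [NormedAddCommGroup H] [InnerProductSpace ℂ H]

/-- `ker (S - z)` as a subspace of `H`. -/
def eigenspace (S : H →ₗ.[ℂ] H) (z : ℂ) : Submodule ℂ H where
  carrier := {x | ∃ hx : x ∈ S.domain, S ⟨x, hx⟩ = z • x}
  zero_mem' := ⟨S.domain.zero_mem, by
    rw [smul_zero]
    exact S.map_zero⟩
  add_mem' := by
    rintro x y ⟨hx, ex⟩ ⟨hy, ey⟩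
    refine ⟨S.domain.add_mem hx hy, ?_⟩
    rw [smul_add, ← ex, ← ey]
    exact S.map_add ⟨x, hx⟩ ⟨y, hy⟩
  smul_mem' := by
    rintro c x ⟨hx, ex⟩
    refine ⟨S.domain.smul_mem c hx, ?_⟩
    rw [smul_comm, ← ex]
    exact S.map_smul c ⟨x, hx⟩

/-- The graph norm `(‖x‖² + ‖S x‖²)^{1/2}` on `dom S`. -/
def graphNorm (S : H →ₗ.[ℂ] H) (x : S.domain) : ℝ :=
  √(‖(x : H)‖ ^ 2 + ‖S x‖ ^ 2)

variable {D : Type*} [NormedAddCommGroup D] [NormedSpace ℂ D]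

/-- `R : H → D` is the resolvent `(S - z)⁻¹`, viewed as a bounded operator from `H` to the space
`D`, which is embedded into `H` by `ι`. For `D = H`, `ι = id` this is the usual resolvent. -/
def IsResolventInto (ι : D →L[ℂ] H) (S : H →ₗ.[ℂ] H) (z : ℂ) (R : H →L[ℂ] D) : Prop :=
  (∀ y : H, ∃ h : ι (R y) ∈ S.domain, S ⟨ι (R y), h⟩ - z • ι (R y) = y) ∧
    ∀ x : S.domain, ι (R (S x - z • (x : H))) = x

/-- The resolvent set of `S`: those `z` for which `S - z` has an inverse in `B(H)`. -/
def resolventSet (S : H →ₗ.[ℂ] H) : Set ℂ :=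
  {z | ∃ R : H →L[ℂ] H, IsResolventInto (ContinuousLinearMap.id ℂ H) S z R}

/-- `Spec S`. -/
def spec (S : H →ₗ.[ℂ] H) : Set ℂ := (resolventSet S)ᶜ

open Classical in
/-- The operator `(S - z)⁻¹` in `B(H, D)` (unique when `ι` is injective, and `0` by convention if
there is no such bounded operator). -/
def resolventInto (ι : D →L[ℂ] H) (S : H →ₗ.[ℂ] H) (z : ℂ) : H →L[ℂ] D :=
  if h : ∃ R : H →L[ℂ] D, IsResolventInto ι S z R then h.choose else 0

/-- The Riesz projection `-(2πi)⁻¹ ∮ (S - ζ)⁻¹ dζ` over the positively oriented circle of radius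
`r` around `lam`, the integral being taken in `B(H, D)`. -/
def rieszProjection (ι : D →L[ℂ] H) (S : H →ₗ.[ℂ] H) (lam : ℂ) (r : ℝ) : H →L[ℂ] D :=
  -((2 * (Real.pi : ℂ) * Complex.I)⁻¹) • circleIntegral (fun ζ => resolventInto ι S ζ) lam r

/-- The real numbers `Λ j`, `j < m`, list the spectrum of `S` in the set `B`, which consists of
eigenvalues, each one repeated according to its multiplicity. -/
structure IsEigenvalueList (S : H →ₗ.[ℂ] H) (B : Set ℂ) {m : ℕ} (Λ : Fin m → ℝ) : Prop where
  mem : ∀ j, (Λ j : ℂ) ∈ B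
  mem_spec_iff : ∀ z ∈ B, z ∈ spec S ↔ ∃ j, (Λ j : ℂ) = z
  multiplicity : ∀ z ∈ B, Nat.card {j // (Λ j : ℂ) = z} = Module.finrank ℂ (eigenspace S z)

end Operators

/-! ### The boundary space `𝔥 × 𝔥` and its symplectic structure -/

section Boundary

variable {𝔥 : Type*} [NormedAddCommGroup 𝔥] [InnerProductSpace ℂ 𝔥]

/-- `ω((f₁,f₂),(g₁,g₂)) = ⟨f₂,g₁⟩ - ⟨f₁,g₂⟩`, where `⟨·,·⟩` is linear in the first argument. -/
def symplecticForm (f g : WithLp 2 (𝔥 × 𝔥)) : ℂ :=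
  inner ℂ g.fst f.snd - inner ℂ g.snd f.fst

variable (𝔥) in
/-- `J (f₁, f₂) = (f₂, -f₁)`. -/
def symplecticJ : WithLp 2 (𝔥 × 𝔥) →L[ℂ] WithLp 2 (𝔥 × 𝔥) :=
  ((WithLp.prodContinuousLinearEquiv 2 ℂ 𝔥 𝔥).symm : 𝔥 × 𝔥 →L[ℂ] WithLp 2 (𝔥 × 𝔥)) ∘L
    (((ContinuousLinearMap.snd ℂ 𝔥 𝔥).prod (-ContinuousLinearMap.fst ℂ 𝔥 𝔥)) ∘L
      ((WithLp.prodContinuousLinearEquiv 2 ℂ 𝔥 𝔥) : WithLp 2 (𝔥 × 𝔥) →L[ℂ] 𝔥 × 𝔥))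

/-- A subset is Lagrangian if it coincides with its `ω`-annihilator. -/
def IsLagrangian (F : Set (WithLp 2 (𝔥 × 𝔥))) : Prop :=
  F = {f | ∀ g ∈ F, symplecticForm f g = 0}

end Boundary

/-! ### Traces and families of self-adjoint extensions -/

section Family

variable {H : Type*} [NormedAddCommGroup H] [InnerProductSpace ℂ H] [CompleteSpace H]
  {𝔥 : Type*} [NormedAddCommGroup 𝔥] [InnerProductSpace ℂ 𝔥]
  {D : Type*} [NormedAddCommGroup D] [NormedSpace ℂ D]

/-- `A` is a densely defined, closed, symmetric operator with equal deficiency indices. -/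
structure IsSymmetricOperator (A : H →ₗ.[ℂ] H) : Prop where
  dense : Dense (A.domain : Set H)
  closed : A.IsClosed
  symm : A.IsFormalAdjoint A
  deficiency : Nonempty
    (eigenspace A.adjoint Complex.I ≃ₗᵢ[ℂ] eigenspace A.adjoint (-Complex.I))

/-- The Banach space `D` is, via `ι`, a subspace of `dom A*` that contains `dom A`, is a core for
`A*` (that is, is dense in `dom A*` for the graph norm), and embeds continuously into `dom A*`
with the graph norm. -/
structure IsTraceDomain (A : H →ₗ.[ℂ] H) (ι : D →L[ℂ] H) : Prop where
  injective : Function.Injective ι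
  core : A.adjoint.HasCore (LinearMap.range (ι : D →ₗ[ℂ] H))
  domain_le : A.domain ≤ LinearMap.range (ι : D →ₗ[ℂ] H)
  bound : ∃ C : ℝ, ∀ (u : D) (hu : ι u ∈ A.adjoint.domain),
    graphNorm A.adjoint ⟨ι u, hu⟩ ≤ C * ‖u‖

/-- `T : D → 𝔥 × 𝔥` is a trace operator: it has dense range and satisfies the abstract Green
identity `⟨A*u, v⟩ - ⟨u, A*v⟩ = ω(Tu, Tv)`. -/
structure IsTraceOperator (A : H →ₗ.[ℂ] H) (ι : D →L[ℂ] H)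
    (T : D →L[ℂ] WithLp 2 (𝔥 × 𝔥)) : Prop where
  denseRange : DenseRange T
  green : ∀ (u v : D) (hu : ι u ∈ A.adjoint.domain) (hv : ι v ∈ A.adjoint.domain),
    inner ℂ (ι v) (A.adjoint ⟨ι u, hu⟩) - inner ℂ (A.adjoint ⟨ι v, hv⟩) (ι u) =
      symplecticForm (T u) (T v)

/-- The data at one value of the parameter: `T` is a trace operator, `Q` is the orthogonal
projection onto a Lagrangian plane, `E` is a self-adjoint extension of `A` with `dom E ⊆ D` and
`closure (T (dom E)) = ran Q`, and `V` is a bounded self-adjoint operator. -/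
structure IsAdmissible [CompleteSpace 𝔥] (A : H →ₗ.[ℂ] H) (ι : D →L[ℂ] H)
    (T : D →L[ℂ] WithLp 2 (𝔥 × 𝔥))
    (Q : WithLp 2 (𝔥 × 𝔥) →L[ℂ] WithLp 2 (𝔥 × 𝔥))
    (E : H →ₗ.[ℂ] H) (V : H →L[ℂ] H) : Prop where
  trace : IsTraceOperator A ι T
  projection : IsStarProjection Q
  lagrangian : IsLagrangian (Set.range Q)
  selfAdjoint : IsSelfAdjoint E
  extends_op : A ≤ E
  domain_le : E.domain ≤ LinearMap.range (ι : D →ₗ[ℂ] H)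
  closure_trace : closure (T '' {u | ι u ∈ E.domain}) = Set.range Q
  potential : IsSelfAdjoint V

/-- `H = E + V` with `dom H = dom E`. -/
def perturbed (E : H →ₗ.[ℂ] H) (V : H →L[ℂ] H) : H →ₗ.[ℂ] H :=
  (V : H →ₗ[ℂ] H) +ᵥ E

/-- `P V̇ P - (T P)* Q̇ J T P - (T P)* J Ṫ P`, where `P : H → D` is regarded as an operator in `H`
in the first term; `dT`, `dQ`, `dV` stand for the derivatives `Ṫ`, `Q̇`, `V̇`. -/
def firstOrderOperator [CompleteSpace 𝔥] (ι : D →L[ℂ] H) (P : H →L[ℂ] D)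
    (T dT : D →L[ℂ] WithLp 2 (𝔥 × 𝔥))
    (dQ : WithLp 2 (𝔥 × 𝔥) →L[ℂ] WithLp 2 (𝔥 × 𝔥)) (dV : H →L[ℂ] H) : H →L[ℂ] H :=
  (ι ∘L P) ∘L dV ∘L (ι ∘L P)
    - (ContinuousLinearMap.adjoint (T ∘L P)) ∘L dQ ∘L symplecticJ 𝔥 ∘L (T ∘L P)
    - (ContinuousLinearMap.adjoint (T ∘L P)) ∘L symplecticJ 𝔥 ∘L (dT ∘L P)

/-- `u` is an orthonormal family of eigenvectors of `K` in the subspace `N`, with eigenvalues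
`μ j`. The vectors are given as elements of `D`. -/
structure IsEigenbasisIn (ι : D →L[ℂ] H) (N : Submodule ℂ H) (K : H →L[ℂ] H) {m : ℕ}
    (u : Fin m → D) (μ : Fin m → ℝ) : Prop where
  orthonormal : Orthonormal ℂ (fun j => ι (u j))
  mem : ∀ j, ι (u j) ∈ N
  eigen : ∀ j, K (ι (u j)) = (μ j : ℂ) • ι (u j)

end Family

end Hadamard

end

/-! The unbounded problem is turned into one for bounded self-adjoint operators. The real point `a =
lam - r` lies on the circle and in the resolvent set, so near `t₀` the operators `R t = (H_t - a)⁻¹`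
exist and are bounded and self-adjoint. Inversion at this boundary point of the disc maps the open
disc onto the half-plane `Re w > 1/(2r)` and sends `lam` to `1/r`. Hence the spectrum of `H_t` in
the disc, with multiplicities, is the part of the spectrum of `R t` above `1/(2r)`
(`IsUpperEigenvalueList.isEigenvalueList`).

The family `R t` is differentiable at `t₀` in operator norm (`hasParamDeriv_resolvent`). The Green
identity and the Lagrangian condition express `R t - R t₀` as a sum of terms each containing exactly
one of the differences of `T`, `Q`, `V` (`resolvent_sub_eq`). The remaining factors converge,
because the resolvents are continuous into `D`. Since `R t₀ = 1/r` on the eigenspace, the derivative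
compressed to it is `-r⁻² T⁽¹⁾`, up to the differentiated Green identity.

For bounded operators, no analyticity in `t` is available or needed. In a basis diagonalizing the
compressed derivative, the quadratic form of `R t` is diagonal up to `o(t - t₀)`, and it stays below
`1/(2r)` on the complement (`IsUpperSpectralProjection.form_bounds`). Min-max comparison
(`le_of_form_le`) then yields eigenvalues `κ j = 1/r - (μ j / r²)(t - t₀) + o(t - t₀)`, and `lam - r
+ 1/κ j` has derivative `μ j`.

The Riesz projection is identified with the spectral projection of `R t₀` by splitting the integrand
into a simple pole at `lam` and an analytic part (`comp_rieszProjection`). -/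

noncomputable section

namespace Hadamard

/-! ### Resolvent identities and the spectral mapping for a resolvent. -/

section Resolvent

variable {H : Type*} [NormedAddCommGroup H] [InnerProductSpace ℂ H]
  {D : Type*} [NormedAddCommGroup D] [NormedSpace ℂ D]
  {ι : D →L[ℂ] H} {S : H →ₗ.[ℂ] H} {z : ℂ} {ρ : H →L[ℂ] D}

theorem perturbed_apply (V : H →L[ℂ] H) (x : (perturbed S V).domain) :
    perturbed S V x = V x + S ⟨x, x.2⟩ := rfl

theorem perturbed_zero (S : H →ₗ.[ℂ] H) : perturbed S 0 = S := by
  simp [perturbed]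

theorem IsResolventInto.toHilbert (h : IsResolventInto ι S z ρ) :
    IsResolventInto (ContinuousLinearMap.id ℂ H) S z (ι ∘L ρ) :=
  ⟨fun y => h.1 y, fun x => h.2 x⟩

theorem IsResolventInto.unique (hι : Function.Injective ι) (h : IsResolventInto ι S z ρ)
    {ρ' : H →L[ℂ] D} (h' : IsResolventInto ι S z ρ') : ρ = ρ' := by
  ext y
  obtain ⟨hx, e⟩ := h.1 y
  apply hι
  have := h'.2 ⟨_, hx⟩
  rw [e] at this
  exact this.symm

theorem IsResolventInto.resolventInto_eq (hι : Function.Injective ι)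
    (h : IsResolventInto ι S z ρ) : resolventInto ι S z = ρ := by
  have hex : ∃ R : H →L[ℂ] D, IsResolventInto ι S z R := ⟨ρ, h⟩
  rw [resolventInto, dif_pos hex]
  exact hex.choose_spec.unique hι h

/-- On the domain, `S + V - z' = (1 + (V + z - z')(S - z)⁻¹)(S - z)`, so inverting the bounded
factor suffices. The result still maps into `D`, because `ρ` is applied last. -/
theorem IsResolventInto.perturb (h : IsResolventInto ι S z ρ) (V : H →L[ℂ] H) (z' : ℂ)
    (U : H →L[ℂ] H) (hU : (1 + (V + (z - z') • 1) * (ι ∘L ρ)) * U = 1)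
    (hU' : U * (1 + (V + (z - z') • 1) * (ι ∘L ρ)) = 1) :
    IsResolventInto ι (perturbed S V) z' (ρ ∘L U) := by
  constructor
  · intro y
    obtain ⟨hx, e⟩ := h.1 (U y)
    refine ⟨hx, ?_⟩
    rw [perturbed_apply]
    have h1 := congrArg (fun K : H →L[ℂ] H => K y) hU
    simp only [mul_apply_eq_comp, add_apply,
      one_apply_eq_self, smul_apply,
      ContinuousLinearMap.comp_apply] at h1 ⊢
    linear_combination (norm := module) h1 + e
  · rintro ⟨x, hx⟩
    have h1 := congrArg (fun K : H →L[ℂ] H => K (S ⟨x, hx⟩ - z • x)) hU'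
    have h2 := h.2 ⟨x, hx⟩
    simp only [mul_apply_eq_comp, add_apply,
      one_apply_eq_self, smul_apply,
      ContinuousLinearMap.comp_apply, h2] at h1
    rw [perturbed_apply]
    have h3 : V x + S ⟨x, hx⟩ - z' • x = S ⟨x, hx⟩ - z • x + (V x + (z - z') • x) := by module
    simp only [ContinuousLinearMap.comp_apply, h3, h1, h2]

theorem IsResolventInto.perturb_inverse (h : IsResolventInto ι S z ρ) (V : H →L[ℂ] H) (z' : ℂ)
    (hU : IsUnit (1 + (V + (z - z') • 1) * (ι ∘L ρ))) :
    IsResolventInto ι (perturbed S V) z'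
      (ρ ∘L Ring.inverse (1 + (V + (z - z') • 1) * (ι ∘L ρ))) :=
  h.perturb V z' _ (Ring.mul_inverse_cancel _ hU) (Ring.inverse_mul_cancel _ hU)

/-- The converse of the factorization: `(S - z)(S + V - z')⁻¹ = 1 - (V + z - z')R` is an explicit
inverse of the bounded factor. -/
theorem IsResolventInto.isUnit_of_perturbed (h : IsResolventInto ι S z ρ) {V : H →L[ℂ] H}
    {z' : ℂ} {R : H →L[ℂ] H}
    (h' : IsResolventInto (ContinuousLinearMap.id ℂ H) (perturbed S V) z' R) :
    IsUnit (1 + (V + (z - z') • 1) * (ι ∘L ρ)) := by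
  refine isUnit_iff_exists.2 ⟨1 - (V + (z - z') • 1) * R, ?_, ?_⟩
  · ext y
    obtain ⟨hx, e⟩ := h'.1 y
    have h2 := h.2 ⟨_, hx⟩
    rw [perturbed_apply] at e
    simp only [mul_apply_eq_comp, add_apply,
      one_apply_eq_self, smul_apply, sub_apply,
      ContinuousLinearMap.comp_apply, ContinuousLinearMap.id_apply] at e h2 ⊢
    have h3 : y - (V (R y) + (z - z') • R y) = S ⟨R y, hx⟩ - z • R y := by
      linear_combination (norm := module) -e
    rw [h3, h2]
    linear_combination (norm := module) e
  · ext y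
    obtain ⟨hx, e⟩ := h.1 y
    have h2 := h'.2 ⟨_, hx⟩
    rw [perturbed_apply] at h2
    simp only [mul_apply_eq_comp, add_apply,
      one_apply_eq_self, smul_apply, sub_apply,
      ContinuousLinearMap.comp_apply, ContinuousLinearMap.id_apply] at e h2 ⊢
    have h3 : y + (V (ι (ρ y)) + (z - z') • ι (ρ y))
        = V (ι (ρ y)) + S ⟨ι (ρ y), hx⟩ - z' • ι (ρ y) := by
      linear_combination (norm := module) -e
    rw [h3, h2, ← h3]
    module

theorem IsResolventInto.mem_resolventSet_iff {R : H →L[ℂ] H} {a : ℂ}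
    (h : IsResolventInto (ContinuousLinearMap.id ℂ H) S a R) (z : ℂ) :
    z ∈ resolventSet S ↔ IsUnit (1 + (a - z) • R) := by
  have e : (1 + (a - z) • R) = 1 + (0 + (a - z) • 1) * (ContinuousLinearMap.id ℂ H ∘L R) := by
    simp
  rw [e]
  constructor
  · rintro ⟨R', h'⟩
    rw [← perturbed_zero S] at h'
    exact h.isUnit_of_perturbed h'
  · intro hU
    have := h.perturb_inverse 0 z hU
    rw [perturbed_zero] at this
    exact ⟨_, this⟩

/-- Spectral mapping, from `1 + (a - z)R = (z - a)((z - a)⁻¹ - R)`. -/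
theorem IsResolventInto.mem_spec_iff {R : H →L[ℂ] H} {a : ℂ}
    (h : IsResolventInto (ContinuousLinearMap.id ℂ H) S a R) {z : ℂ} (hz : z ≠ a) :
    z ∈ spec S ↔ (z - a)⁻¹ ∈ spectrum ℂ R := by
  have hz' : z - a ≠ 0 := sub_ne_zero.2 hz
  rw [spec, Set.mem_compl_iff, h.mem_resolventSet_iff, spectrum.mem_iff, not_iff_not]
  have e : 1 + (a - z) • R
      = (Units.mk0 (z - a) hz') • (algebraMap ℂ (H →L[ℂ] H) (z - a)⁻¹ - R) := by
    rw [Units.smul_def, Units.val_mk0, smul_sub, Algebra.algebraMap_eq_smul_one, smul_smul,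
      mul_inv_cancel₀ hz', one_smul]
    module
  rw [e, isUnit_smul_iff]

theorem IsResolventInto.mem_eigenspace_iff {R : H →L[ℂ] H} {a : ℂ}
    (h : IsResolventInto (ContinuousLinearMap.id ℂ H) S a R) {z : ℂ} (hz : z ≠ a) (x : H) :
    x ∈ eigenspace S z ↔ R x = (z - a)⁻¹ • x := by
  have hz' : z - a ≠ 0 := sub_ne_zero.2 hz
  constructor
  · rintro ⟨hx, e⟩
    have := h.2 ⟨x, hx⟩
    rw [e, ← sub_smul, map_smul] at this
    simp only [ContinuousLinearMap.id_apply] at this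
    nth_rewrite 2 [← this]
    rw [smul_smul, inv_mul_cancel₀ hz', one_smul]
  · intro e
    obtain ⟨hx, e'⟩ := h.1 x
    simp only [ContinuousLinearMap.id_apply] at hx e'
    have ex : x = (z - a) • R x := by rw [e, smul_smul, mul_inv_cancel₀ hz', one_smul]
    have hx' : x ∈ S.domain := by
      rw [ex]; exact S.domain.smul_mem _ hx
    refine ⟨hx', ?_⟩
    have : (⟨x, hx'⟩ : S.domain) = (z - a) • ⟨R x, hx⟩ := Subtype.ext ex
    rw [this, S.map_smul, eq_add_of_sub_eq e', smul_add, smul_smul, mul_comm, ← smul_smul, ← ex]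
    module

/-- The cross term vanishes because `⟨S x, x⟩` is real for symmetric `S`. -/
theorem norm_sub_I_smul_sq (hS : S.IsFormalAdjoint S) (x : S.domain) :
    ‖S x - Complex.I • (x : H)‖ ^ 2 = ‖S x‖ ^ 2 + ‖(x : H)‖ ^ 2 := by
  have h : (inner ℂ (S x) (x : H)).im = 0 := by
    have h1 := hS x x
    rw [← inner_conj_symm (x : H) (S x)] at h1
    exact Complex.conj_eq_iff_im.1 h1.symm
  have h2 := norm_sub_sq (𝕜 := ℂ) (S x) (Complex.I • (x : H))
  rw [h2, inner_smul_right, norm_smul]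
  simp [h]

end Resolvent

/-! ### Self-adjointness and the resolvent at `i`. -/

section SelfAdjoint

variable {H : Type*} [NormedAddCommGroup H] [InnerProductSpace ℂ H] [CompleteSpace H]
  {S : H →ₗ.[ℂ] H}

theorem isFormalAdjoint_of_isSelfAdjoint (hS : IsSelfAdjoint S) : S.IsFormalAdjoint S := by
  have h := S.adjoint_isFormalAdjoint hS.dense_domain
  rwa [LinearPMap.isSelfAdjoint_def.1 hS] at h

theorem perturbed_isFormalAdjoint (hS : S.IsFormalAdjoint S) {V : H →L[ℂ] H}
    (hV : IsSelfAdjoint V) : (perturbed S V).IsFormalAdjoint (perturbed S V) := by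
  rintro ⟨x, hx⟩ ⟨y, hy⟩
  have h1 := hS ⟨x, hx⟩ ⟨y, hy⟩
  have h2 := hV.isSymmetric x y
  simp only [ContinuousLinearMap.coe_coe] at h1 h2
  rw [perturbed_apply, perturbed_apply, inner_add_left, inner_add_right]
  simp only
  rw [h1, h2]

theorem IsResolventInto.isSelfAdjoint (hS : S.IsFormalAdjoint S) {R : H →L[ℂ] H} {a : ℝ}
    (h : IsResolventInto (ContinuousLinearMap.id ℂ H) S a R) : IsSelfAdjoint R := by
  rw [ContinuousLinearMap.isSelfAdjoint_iff_isSymmetric]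
  intro x y
  obtain ⟨hx, ex⟩ := h.1 x
  obtain ⟨hy, ey⟩ := h.1 y
  have h1 := hS ⟨_, hx⟩ ⟨_, hy⟩
  simp only [ContinuousLinearMap.id_apply, ContinuousLinearMap.coe_coe] at *
  nth_rewrite 2 [← ex]
  nth_rewrite 1 [← ey]
  rw [inner_sub_left, inner_sub_right, h1, inner_smul_left, inner_smul_right]
  simp

/-- On the complete graph of `S`, the map `S - i` is bounded below, so it is injective with closed
range. A vector orthogonal to the range is an eigenvector of `S* = S` for `-i`, hence zero by
symmetry. -/
theorem exists_isResolventInto_I (hS : IsSelfAdjoint S) :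
    ∃ R : H →L[ℂ] H, IsResolventInto (ContinuousLinearMap.id ℂ H) S Complex.I R := by
  have hsymm := isFormalAdjoint_of_isSelfAdjoint hS
  have hcl : IsClosed (S.graph : Set (H × H)) := hS.isClosed
  have : CompleteSpace S.graph := hcl.completeSpace_coe
  let φ : S.graph →L[ℂ] H :=
    (ContinuousLinearMap.snd ℂ H H - Complex.I • ContinuousLinearMap.fst ℂ H H) ∘L
      S.graph.subtypeL
  have hφ : ∀ x : S.domain, φ ⟨_, S.mem_graph x⟩ = S x - Complex.I • (x : H) := fun x => rfl
  have hrep : ∀ g : S.graph, ∃ x : S.domain, g = ⟨_, S.mem_graph x⟩ := by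
    rintro ⟨⟨u, w⟩, hg⟩
    obtain ⟨x, h1, h2⟩ := (S.mem_graph_iff).1 hg
    exact ⟨x, Subtype.ext (Prod.ext h1.symm h2.symm)⟩
  have hanti : AntilipschitzWith 1 φ := by
    refine AddMonoidHomClass.antilipschitz_of_bound φ fun g => ?_
    obtain ⟨x, rfl⟩ := hrep g
    rw [hφ, NNReal.coe_one, one_mul]
    have h := norm_sub_I_smul_sq hsymm x
    have : ‖(⟨_, S.mem_graph x⟩ : S.graph)‖ = max ‖(x : H)‖ ‖S x‖ := rfl
    rw [this]
    refine max_le ?_ ?_ <;> refine le_of_sq_le_sq ?_ (norm_nonneg _) <;> rw [h] <;>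
      nlinarith [sq_nonneg ‖S x‖, sq_nonneg ‖(x : H)‖]
  have hclosed : IsClosed (Set.range φ) := hanti.isClosed_range φ.uniformContinuous
  have hperp : (LinearMap.range (φ : S.graph →ₗ[ℂ] H))ᗮ = ⊥ := by
    rw [eq_bot_iff]
    intro y hy
    rw [Submodule.mem_orthogonal'] at hy
    have hy' : ∀ x : S.domain, inner ℂ (-Complex.I • y) (x : H) = inner ℂ y (S x) := by
      intro x
      have := hy (φ ⟨_, S.mem_graph x⟩) ⟨_, rfl⟩
      rw [hφ, inner_sub_right, inner_smul_right, sub_eq_zero] at this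
      rw [this, inner_smul_left]
      simp
    have hd : y ∈ S.adjoint.domain := S.mem_adjoint_domain_of_exists y ⟨_, hy'⟩
    have he : S.adjoint ⟨y, hd⟩ = -Complex.I • y := S.adjoint_apply_eq hS.dense_domain ⟨y, hd⟩ hy'
    have hgr : (y, -Complex.I • y) ∈ S.graph := by
      rw [← LinearPMap.isSelfAdjoint_def.1 hS, ← he]
      exact S.adjoint.mem_graph ⟨y, hd⟩
    obtain ⟨x, h1, h2⟩ := (S.mem_graph_iff).1 hgr
    have h3 := hsymm x x
    simp only at h1 h2
    rw [h1, h2, inner_smul_left, inner_smul_right] at h3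
    have h4 : 2 * Complex.I * inner ℂ y y = 0 := by
      have : (starRingEnd ℂ) (-Complex.I) = Complex.I := by simp
      rw [this] at h3
      linear_combination h3
    rw [mul_eq_zero, or_iff_right (by simp), inner_self_eq_zero] at h4
    exact h4
  have hker : LinearMap.ker (φ : S.graph →ₗ[ℂ] H) = ⊥ := LinearMap.ker_eq_bot.2 hanti.injective
  have hrange : LinearMap.range (φ : S.graph →ₗ[ℂ] H) = ⊤ := by
    have hc : IsClosed (LinearMap.range (φ : S.graph →ₗ[ℂ] H) : Set H) := by
      rw [LinearMap.coe_range]; exact hclosed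
    have := hc.completeSpace_coe
    rw [← Submodule.orthogonal_orthogonal (LinearMap.range (φ : S.graph →ₗ[ℂ] H)), hperp,
      Submodule.bot_orthogonal_eq_top]
  let e := ContinuousLinearEquiv.ofBijective φ hker hrange
  have hes : ∀ g, e g = φ g := fun g => rfl
  refine ⟨ContinuousLinearMap.fst ℂ H H ∘L S.graph.subtypeL ∘L (e.symm : H →L[ℂ] S.graph), ?_, ?_⟩
  · intro y
    obtain ⟨x, hx⟩ := hrep (e.symm y)
    have h2 := hes (e.symm y)
    rw [e.apply_symm_apply, hx, hφ] at h2
    have h3 : (ContinuousLinearMap.fst ℂ H H ∘L S.graph.subtypeL ∘L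
      (e.symm : H →L[ℂ] S.graph)) y = x := by
      simp [hx]
    refine ⟨?_, ?_⟩
    · rw [h3]; exact x.2
    · simp only [h3]; exact h2.symm
  · intro x
    have h2 := hes ⟨_, S.mem_graph x⟩
    rw [hφ] at h2
    simp [← h2]

end SelfAdjoint

/-! ### Boundedness of resolvents into the trace domain. -/

section Lift

variable {H : Type*} [NormedAddCommGroup H] [NormedSpace ℂ H] [CompleteSpace H]
  {D : Type*} [NormedAddCommGroup D] [NormedSpace ℂ D] [CompleteSpace D]

/-- A bounded operator with range in a continuously embedded Banach space is bounded as an operator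
into that space. -/
theorem exists_lift_of_range_le {ι : D →L[ℂ] H} (hι : Function.Injective ι) (R : H →L[ℂ] H)
    (hR : ∀ y, ∃ d, ι d = R y) : ∃ ρ : H →L[ℂ] D, ι ∘L ρ = R := by
  choose g hg using hR
  let G : H →ₗ[ℂ] D :=
    { toFun := g
      map_add' := fun x y => hι (by simp [hg])
      map_smul' := fun c x => hι (by simp [hg]) }
  -- Closed graph theorem: a limit in `D` is determined by its image in `H`, where `R` is
  -- continuous.
  refine ⟨ContinuousLinearMap.ofSeqClosedGraph (g := G) ?_, ?_⟩
  · intro u x y hu hy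
    apply hι
    have h1 : Filter.Tendsto (fun n => ι (g (u n))) Filter.atTop (nhds (ι y)) :=
      (ι.continuous.tendsto y).comp hy
    simp only [hg] at h1
    exact (tendsto_nhds_unique h1 ((R.continuous.tendsto x).comp hu)).trans (hg x).symm
  · ext y
    exact hg y

end Lift

theorem exists_isResolventInto_I_of_domain_le
    {H : Type*} [NormedAddCommGroup H] [InnerProductSpace ℂ H] [CompleteSpace H]
    {D : Type*} [NormedAddCommGroup D] [NormedSpace ℂ D] [CompleteSpace D]
    {ι : D →L[ℂ] H} (hι : Function.Injective ι) {E : H →ₗ.[ℂ] H} (hE : IsSelfAdjoint E)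
    (hdom : E.domain ≤ LinearMap.range (ι : D →ₗ[ℂ] H)) :
    ∃ ρ : H →L[ℂ] D, IsResolventInto ι E Complex.I ρ := by
  obtain ⟨R, hR⟩ := Hadamard.exists_isResolventInto_I hE
  obtain ⟨ρ, hρ⟩ := exists_lift_of_range_le hι R fun y => hdom (hR.1 y).1
  refine ⟨ρ, fun y => ?_, fun x => ?_⟩
  · have := hR.1 y
    rw [← hρ] at this
    exact this
  · have := hR.2 x
    rw [← hρ] at this
    exact this

/-! ### Spectral projections at a spectral gap. -/

section SpectralProjection

variable {H : Type*} [NormedAddCommGroup H] [InnerProductSpace ℂ H] [CompleteSpace H]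

/-- `q` is a spectral projection of the bounded self-adjoint operator `K` for the half-line
`(b, ∞)`, and the spectrum of `K` below `b` lies in `(-∞, c]`. -/
structure IsUpperSpectralProjection (K q : H →L[ℂ] H) (b c : ℝ) : Prop where
  isStarProjection : IsStarProjection q
  commute : Commute K q
  lower : ∀ x, q x = x → b * ‖x‖ ^ 2 ≤ (inner ℂ x (K x)).re
  upper : ∀ x, q x = 0 → (inner ℂ x (K x)).re ≤ c * ‖x‖ ^ 2
  aeval_mul_eq_zero_iff : ∀ p : Polynomial ℝ, Polynomial.aeval K p * q = 0 ↔
    ∀ s ∈ spectrum ℝ K, b < s → p.eval s = 0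

/-- The step function at `b` is continuous on the spectrum because `b` lies in a gap, so the
continuous functional calculus already gives the projection. Here `c = b - δ`, with `δ` the radius
of a ball around `b` free of spectrum. -/
theorem exists_isUpperSpectralProjection {K : H →L[ℂ] H} (hK : IsSelfAdjoint K) {b : ℝ}
    (hb : b ∉ spectrum ℝ K) : ∃ q c, c < b ∧ IsUpperSpectralProjection K q b c := by
  obtain ⟨δ, hδ, hball⟩ := Metric.isOpen_iff.1 (spectrum.isClosed (𝕜 := ℝ) K).isOpen_compl b hb
  have hgap : ∀ s ∈ spectrum ℝ K, s ≤ b → s ≤ b - δ := by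
    intro s hs hsb
    by_contra! h
    exact hball (show s ∈ Metric.ball b δ by
      rw [Metric.mem_ball, Real.dist_eq, abs_sub_lt_iff]; constructor <;> linarith) hs
  let g : ℝ → ℝ := fun s => if s ≤ b then 0 else 1
  have hg : ContinuousOn g (spectrum ℝ K) := by
    intro s hs
    rcases lt_or_ge s b with h | h
    · refine (continuousAt_const (y := (0 : ℝ))).congr ?_ |>.continuousWithinAt
      filter_upwards [Iio_mem_nhds h] with y hy
      simp [g, le_of_lt (Set.mem_Iio.1 hy)]
    · have h' : b < s := lt_of_le_of_ne h fun e => hb (e ▸ hs)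
      refine (continuousAt_const (y := (1 : ℝ))).congr ?_ |>.continuousWithinAt
      filter_upwards [Ioi_mem_nhds h'] with y hy
      simp [g, Set.mem_Ioi.1 hy]
  have hmul : ∀ p : Polynomial ℝ,
      Polynomial.aeval K p * cfc g K = cfc (fun s => p.eval s * g s) K := by
    intro p
    rw [cfc_mul (fun s => p.eval s) g K p.continuous.continuousOn hg]
    rw [← cfc_polynomial p K]
  have hmul' : ∀ p : Polynomial ℝ,
      Polynomial.aeval K p * (1 - cfc g K) = cfc (fun s => p.eval s * (1 - g s)) K := by
    intro p
    rw [cfc_mul (fun s => p.eval s) (fun s => 1 - g s) K p.continuous.continuousOn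
      (continuousOn_const.sub hg), cfc_sub (fun _ => (1 : ℝ)) g K continuousOn_const hg,
      cfc_const_one ℝ K]
    rw [← cfc_polynomial p K]
  have hpos : ∀ (p : Polynomial ℝ) (x : H), 0 ≤ Polynomial.aeval K p * cfc g K → cfc g K x = x →
      0 ≤ (inner ℂ x (Polynomial.aeval K p x)).re := by
    intro p x h hx
    rw [ContinuousLinearMap.nonneg_iff_isPositive] at h
    have := h.re_inner_nonneg_right x
    rwa [mul_apply_eq_comp, hx] at this
  have hpos' : ∀ (p : Polynomial ℝ) (x : H), 0 ≤ Polynomial.aeval K p * (1 - cfc g K) →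
      cfc g K x = 0 → 0 ≤ (inner ℂ x (Polynomial.aeval K p x)).re := by
    intro p x h hx
    rw [ContinuousLinearMap.nonneg_iff_isPositive] at h
    have := h.re_inner_nonneg_right x
    rwa [mul_apply_eq_comp, sub_apply, one_apply_eq_self, hx, sub_zero] at this
  refine ⟨cfc g K, b - δ, by linarith, ⟨?_, cfc_predicate g K⟩, ?_, ?_, ?_, ?_⟩
  · rw [IsIdempotentElem, ← cfc_mul g g K hg hg]
    congr 1
    ext s
    simp [g]
  · have := cfc_commute_cfc (fun s => s) g K
    rwa [cfc_id' ℝ K] at this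
  · intro x hx
    have h := hpos (Polynomial.X - Polynomial.C b) x ?_ hx
    · simp only [map_sub, Polynomial.aeval_X, Polynomial.aeval_C, sub_apply,
        Algebra.algebraMap_eq_smul_one, smul_apply, one_apply_eq_self, inner_sub_right,
        Complex.sub_re, ← Complex.coe_smul, inner_smul_right, Complex.re_ofReal_mul] at h
      have h2 := inner_self_eq_norm_sq (𝕜 := ℂ) x
      simp only [RCLike.re_eq_complex_re] at h2
      rw [h2] at h
      linarith
    · rw [hmul]
      refine cfc_nonneg fun s hs => ?_
      by_cases h : s ≤ b
      · simp [g, h]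
      · simp [g, h]; linarith
  · intro x hx
    have h := hpos' (Polynomial.C (b - δ) - Polynomial.X) x ?_ hx
    · simp only [map_sub, Polynomial.aeval_X, Polynomial.aeval_C, sub_apply,
        Algebra.algebraMap_eq_smul_one, smul_apply, one_apply_eq_self, inner_sub_right,
        Complex.sub_re, ← Complex.coe_smul, inner_smul_right, Complex.re_ofReal_mul] at h
      have h2 := inner_self_eq_norm_sq (𝕜 := ℂ) x
      simp only [RCLike.re_eq_complex_re] at h2
      rw [h2] at h
      linarith
    · rw [hmul']
      refine cfc_nonneg fun s hs => ?_
      by_cases h : s ≤ b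
      · have := hgap s hs h
        simp [g, h]; linarith
      · simp [g, h]
  · intro p
    rw [hmul, ← cfc_const_zero ℝ K,
      cfc_eq_cfc_iff_eqOn hK
        (show ContinuousOn (fun s => p.eval s * g s) _ from p.continuous.continuousOn.mul hg)
        continuousOn_const]
    refine forall₂_congr fun s hs => ?_
    by_cases h : s ≤ b
    · simp [g, h]
    · simp [g, h, lt_of_not_ge h]

end SpectralProjection

/-! ### Min-max comparison of quadratic forms. -/

section MinMax

variable {H : Type*} [NormedAddCommGroup H] [InnerProductSpace ℂ H]

theorem norm_sq_sum_smul_of_orthonormal {m : ℕ} {e : Fin m → H} (he : Orthonormal ℂ e)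
    (c : Fin m → ℂ) : ‖∑ j, c j • e j‖ ^ 2 = ∑ j, ‖c j‖ ^ 2 := by
  have h := he.inner_sum c c Finset.univ
  rw [inner_self_eq_norm_sq_to_K] at h
  have h2 : ∀ j, (starRingEnd ℂ) (c j) * c j = ((‖c j‖ ^ 2 : ℝ) : ℂ) := by
    intro j
    rw [mul_comm, Complex.mul_conj, Complex.normSq_eq_norm_sq]
  simp only [h2] at h
  refine Complex.ofReal_injective ?_
  push_cast at h ⊢
  exact h

/-- Comparison of eigenvalues through quadratic forms: a form that is at least `diag α` on the span
of an orthonormal family, and at most `diag β` with respect to another one of the same size. -/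
theorem le_of_form_le {m : ℕ} {e f : Fin m → H} (he : Orthonormal ℂ e) (hf : Orthonormal ℂ f)
    {α β : Fin m → ℝ} (hα : Antitone α) (hβ : Antitone β) {γ : ℝ} (hγ : ∀ j, γ ≤ β j)
    {g : H → ℝ} (h1 : ∀ c : Fin m → ℂ, ∑ j, α j * ‖c j‖ ^ 2 ≤ g (∑ j, c j • e j))
    (h2 : ∀ x, g x ≤ ∑ j, β j * ‖inner ℂ (f j) x‖ ^ 2
      + γ * (‖x‖ ^ 2 - ∑ j, ‖inner ℂ (f j) x‖ ^ 2)) (k : Fin m) : α k ≤ β k := by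
  -- The min-max dimension count: orthogonality to `f i` for `i < k` and `c i = 0` for `i > k` are
  -- `m - 1` conditions on `m` coefficients. Padding slot `k` with zero makes `L` an endomorphism
  -- that is not surjective, hence not injective; a nonzero kernel vector is the test vector.
  let L : (Fin m → ℂ) →ₗ[ℂ] (Fin m → ℂ) :=
    { toFun := fun c i => if i < k then inner ℂ (f i) (∑ j, c j • e j)
        else if k < i then c i else 0
      map_add' := fun c d => by
        ext i
        simp only [Pi.add_apply, add_smul, Finset.sum_add_distrib, inner_add_right]
        split_ifs <;> simp only [add_zero]
      map_smul' := fun a c => by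
        ext i
        simp only [Pi.smul_apply, smul_eq_mul, mul_smul, ← Finset.smul_sum, inner_smul_right,
          RingHom.id_apply]
        split_ifs <;> first | rfl | exact (mul_zero _).symm }
  have hL : ∀ c i, L c i = if i < k then inner ℂ (f i) (∑ j, c j • e j)
        else if k < i then c i else 0 := fun _ _ => rfl
  have hni : ¬ Function.Injective L := by
    rw [LinearMap.injective_iff_surjective]
    intro hs
    obtain ⟨c, hc⟩ := hs (Pi.single k 1)
    have := congrFun hc k
    rw [hL] at this
    simp at this
  rw [injective_iff_map_eq_zero] at hni
  push Not at hni
  obtain ⟨c, hc, hc0⟩ := hni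
  set x := ∑ j, c j • e j with hx
  have hc1 : ∀ i, k < i → c i = 0 := by
    intro i hi
    have := congrFun hc i
    rw [hL, if_neg hi.le.not_gt, if_pos hi] at this
    exact this
  have hc2 : ∀ i, i < k → inner ℂ (f i) x = 0 := by
    intro i hi
    have := congrFun hc i
    rw [hL, if_pos hi] at this
    exact this
  have hxn : ‖x‖ ^ 2 = ∑ j, ‖c j‖ ^ 2 := norm_sq_sum_smul_of_orthonormal he c
  have hxpos : 0 < ‖x‖ ^ 2 := by
    obtain ⟨i, hi⟩ : ∃ i, c i ≠ 0 := by
      by_contra! h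
      exact hc0 (funext h)
    rw [hxn]
    exact Finset.sum_pos' (fun _ _ => sq_nonneg _) ⟨i, Finset.mem_univ _, by positivity⟩
  have hbessel : ∑ j, ‖inner ℂ (f j) x‖ ^ 2 ≤ ‖x‖ ^ 2 := hf.sum_inner_products_le x
  have hlow : α k * ‖x‖ ^ 2 ≤ ∑ j, α j * ‖c j‖ ^ 2 := by
    rw [hxn, Finset.mul_sum]
    refine Finset.sum_le_sum fun j _ => ?_
    rcases le_or_gt j k with h | h
    · exact mul_le_mul_of_nonneg_right (hα h) (sq_nonneg _)
    · simp [hc1 j h]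
  have hup : ∑ j, β j * ‖inner ℂ (f j) x‖ ^ 2 ≤ β k * ∑ j, ‖inner ℂ (f j) x‖ ^ 2 := by
    rw [Finset.mul_sum]
    refine Finset.sum_le_sum fun j _ => ?_
    rcases lt_or_ge j k with h | h
    · simp [hc2 j h]
    · exact mul_le_mul_of_nonneg_right (hβ h) (sq_nonneg _)
  have h3 : γ * (‖x‖ ^ 2 - ∑ j, ‖inner ℂ (f j) x‖ ^ 2)
      ≤ β k * (‖x‖ ^ 2 - ∑ j, ‖inner ℂ (f j) x‖ ^ 2) :=
    mul_le_mul_of_nonneg_right (hγ k) (by linarith)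
  refine le_of_mul_le_mul_right ?_ hxpos
  linarith [h1 c, h2 x]

/-- A symmetric operator is diagonalized by an orthonormal basis of a finite-dimensional invariant
subspace. -/
theorem exists_orthonormal_eigenbasis {K : H →ₗ[ℂ] H} (hK : K.IsSymmetric) {M : Submodule ℂ H}
    [FiniteDimensional ℂ M] {m : ℕ} (hm : Module.finrank ℂ M = m) (hM : ∀ x ∈ M, K x ∈ M) :
    ∃ (f : Fin m → H) (κ : Fin m → ℝ), Antitone κ ∧ Orthonormal ℂ f ∧ (∀ j, f j ∈ M) ∧
      (∀ j, K (f j) = (κ j : ℂ) • f j) ∧ ∀ x ∈ M, ∑ j, inner ℂ (f j) x • f j = x := by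
  have hR := hK.restrict_invariant hM
  refine ⟨fun j => hR.eigenvectorBasis hm j, hR.eigenvalues hm, hR.eigenvalues_antitone hm, ?_,
    fun j => (hR.eigenvectorBasis hm j).2, fun j => ?_, fun x hx => ?_⟩
  · exact (hR.eigenvectorBasis hm).orthonormal.comp_linearIsometry M.subtypeₗᵢ
  · have := congrArg Subtype.val (hR.apply_eigenvectorBasis hm j)
    exact this
  · have := congrArg Subtype.val ((hR.eigenvectorBasis hm).sum_repr' ⟨x, hx⟩)
    rw [Submodule.coe_sum] at this
    exact this

end MinMax

/-! ### Eigenvalues of a bounded self-adjoint operator above a gap. -/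

section UpperEigenvalues

variable {H : Type*} [NormedAddCommGroup H] [InnerProductSpace ℂ H]

/-- The part of the spectrum of `K` with real part above `b` consists of eigenvalues, listed by `κ`
with their multiplicities. -/
structure IsUpperEigenvalueList (K : H →L[ℂ] H) (b : ℝ) {m : ℕ} (κ : Fin m → ℝ) : Prop where
  lt : ∀ j, b < κ j
  mem_spectrum_iff : ∀ w : ℂ, b < w.re → (w ∈ spectrum ℂ K ↔ ∃ j, (κ j : ℂ) = w)
  card_eq : ∀ w : ℂ, b < w.re →
    Nat.card {j // (κ j : ℂ) = w} = Module.finrank ℂ (Module.End.eigenspace (K : H →ₗ[ℂ] H) w)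

theorem IsUpperEigenvalueList.comp_perm {K : H →L[ℂ] H} {b : ℝ} {m : ℕ} {κ : Fin m → ℝ}
    (h : IsUpperEigenvalueList K b κ) (σ : Equiv.Perm (Fin m)) :
    IsUpperEigenvalueList K b (κ ∘ σ) where
  lt j := h.lt _
  mem_spectrum_iff w hw := by
    rw [h.mem_spectrum_iff w hw]
    exact σ.exists_congr_right.symm
  card_eq w hw := by
    rw [← h.card_eq w hw]
    exact Nat.card_congr (σ.subtypeEquiv fun j => Iff.rfl)

theorem mem_spectrum_of_apply_eq_smul {K : H →L[ℂ] H} {w : ℂ} {x : H} (hx : x ≠ 0)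
    (h : K x = w • x) : w ∈ spectrum ℂ K := by
  rw [spectrum.mem_iff]
  rintro ⟨u, hu⟩
  apply hx
  have h1 : (u : H →L[ℂ] H) x = 0 := by
    rw [hu, Algebra.algebraMap_eq_smul_one]
    simp [h]
  have h2 := congrArg (fun A : H →L[ℂ] H => A x) u.inv_mul
  simp only [mul_apply_eq_comp, h1, map_zero, one_apply_eq_self] at h2
  exact h2.symm

theorem aeval_apply_eq_zero {K : H →L[ℂ] H} {κ : ℝ} {x : H} (h : K x = (κ : ℂ) • x)
    {p : Polynomial ℝ} (hp : p.eval κ = 0) : Polynomial.aeval K p x = 0 := by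
  obtain ⟨p', rfl⟩ := Polynomial.dvd_iff_isRoot.2 hp
  rw [mul_comm, map_mul, mul_apply_eq_comp]
  simp [h, Algebra.algebraMap_eq_smul_one]

variable [CompleteSpace H]

/-- The component `x - q x` also satisfies the eigenvalue equation for `w`, but on `ker q` the form
is at most `c < Re w`, so this component is zero. -/
theorem IsUpperSpectralProjection.apply_eq_self {K q : H →L[ℂ] H} {b c : ℝ}
    (hq : IsUpperSpectralProjection K q b c) (hcb : c < b) {w : ℂ} {x : H} (hw : b < w.re)
    (hx : K x = w • x) : q x = x := by
  have hqq : ∀ x, q (q x) = q x := fun x =>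
    congrArg (fun A : H →L[ℂ] H => A x) hq.isStarProjection.isIdempotentElem.eq
  have hKq : ∀ x, q (K x) = K (q x) := fun x =>
    (congrArg (fun A : H →L[ℂ] H => A x) hq.commute.eq).symm
  have h1 : q (x - q x) = 0 := by rw [map_sub, hqq, sub_self]
  have h2 : K (x - q x) = w • (x - q x) := by
    rw [map_sub, ← hKq, hx, map_smul, smul_sub]
  have h3 := hq.upper _ h1
  rw [h2, inner_smul_right, inner_self_eq_norm_sq_to_K] at h3
  have h4 : (w * ((‖x - q x‖ : ℝ) : ℂ) ^ 2).re = w.re * ‖x - q x‖ ^ 2 := by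
    rw [← Complex.ofReal_pow, Complex.re_mul_ofReal]
  have h5 : w.re * ‖x - q x‖ ^ 2 ≤ c * ‖x - q x‖ ^ 2 := h4 ▸ h3
  have h6 : ‖x - q x‖ ^ 2 = 0 := by nlinarith [sq_nonneg ‖x - q x‖]
  have h7 : x - q x = 0 := by simpa using h6
  exact (sub_eq_zero.1 h7).symm

theorem IsUpperSpectralProjection.isUpperEigenvalueList {K q : H →L[ℂ] H} {b c : ℝ}
    (hq : IsUpperSpectralProjection K q b c) (hcb : c < b) (hK : IsSelfAdjoint K)
    (hb : b ∉ spectrum ℝ K) {m : ℕ} {f : Fin m → H} {κ : Fin m → ℝ} (hf : Orthonormal ℂ f)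
    (hκ : ∀ j, K (f j) = (κ j : ℂ) • f j) (hqf : ∀ x, ∑ j, inner ℂ (f j) x • f j = q x) :
    IsUpperEigenvalueList K b κ := by
  have hqfj : ∀ j, q (f j) = f j := by
    intro j
    rw [← hqf]
    rw [orthonormal_iff_ite] at hf
    simp [hf]
  have hspec : ∀ j, (κ j : ℂ) ∈ spectrum ℂ K := fun j =>
    mem_spectrum_of_apply_eq_smul (hf.ne_zero j) (hκ j)
  have hlt : ∀ j, b < κ j := by
    intro j
    have h1 := hq.lower (f j) (hqfj j)
    rw [hκ, inner_smul_right, inner_self_eq_norm_sq_to_K, hf.1 j] at h1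
    simp only [RCLike.ofReal_one, one_pow, mul_one, Complex.ofReal_re] at h1
    refine lt_of_le_of_ne h1 fun e => hb ?_
    rw [← spectrum.algebraMap_mem_iff ℂ, e]
    exact hspec j
  refine ⟨hlt, fun w hw => ⟨fun hws => ?_, ?_⟩, fun w hw => ?_⟩
  · have hre : w = w.re := hK.mem_spectrum_eq_re hws
    have hws' : w.re ∈ spectrum ℝ K := by
      rw [← spectrum.algebraMap_mem_iff ℂ]
      exact hre ▸ hws
    -- This polynomial in `K` annihilates `ran q`, so it must vanish at every spectral point above
    -- `b`: each such point is some `κ j`.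
    have h0 : Polynomial.aeval K (∏ j, (Polynomial.X - Polynomial.C (κ j))) * q = 0 := by
      ext x
      rw [mul_apply_eq_comp, ← hqf, map_sum, zero_apply]
      refine Finset.sum_eq_zero fun j _ => ?_
      rw [map_smul, aeval_apply_eq_zero (hκ j), smul_zero]
      rw [Polynomial.eval_prod]
      exact Finset.prod_eq_zero (Finset.mem_univ j) (by simp)
    have h1 := (hq.aeval_mul_eq_zero_iff _).1 h0 w.re hws' hw
    rw [Polynomial.eval_prod, Finset.prod_eq_zero_iff] at h1
    obtain ⟨j, -, hj⟩ := h1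
    refine ⟨j, ?_⟩
    rw [Polynomial.eval_sub, Polynomial.eval_X, Polynomial.eval_C, sub_eq_zero] at hj
    rw [hre, ← hj]
  · rintro ⟨j, rfl⟩
    exact hspec j
  · have hspan : Module.End.eigenspace (K : H →ₗ[ℂ] H) w
        = Submodule.span ℂ (Set.range fun j : {j // (κ j : ℂ) = w} => f j) := by
      apply le_antisymm
      · intro x hx
        have hx' : K x = w • x := Module.End.mem_eigenspace_iff.1 hx
        rw [← hq.apply_eq_self hcb hw hx', ← hqf]
        refine Submodule.sum_mem _ fun j _ => ?_
        by_cases hj : (κ j : ℂ) = w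
        · exact Submodule.smul_mem _ _ (Submodule.subset_span ⟨⟨j, hj⟩, rfl⟩)
        · have h1 : inner ℂ (f j) (K x) = inner ℂ (K (f j)) x := (hK.isSymmetric (f j) x).symm
          rw [hx', hκ, inner_smul_right, inner_smul_left, Complex.conj_ofReal] at h1
          have h2 : inner ℂ (f j) x = 0 := by
            have : ((κ j : ℂ) - w) * inner ℂ (f j) x = 0 := by linear_combination -h1
            exact (mul_eq_zero.1 this).resolve_left (sub_ne_zero.2 hj)
          rw [h2, zero_smul]
          exact Submodule.zero_mem _
      · rw [Submodule.span_le]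
        rintro _ ⟨⟨j, rfl⟩, rfl⟩
        exact Module.End.mem_eigenspace_iff.2 (hκ j)
    have hli : LinearIndependent ℂ fun j : {j // (κ j : ℂ) = w} => f j :=
      hf.linearIndependent.comp _ Subtype.val_injective
    rw [hspan, finrank_span_eq_card hli, Nat.card_eq_fintype_card]

/-- Eigenvalues of a self-adjoint operator whose quadratic form is, up to `ε`, diagonal with
entries `d j > b` on an orthonormal family and at most `c < b` on its complement. -/
theorem exists_isUpperEigenvalueList_of_antitone {K : H →L[ℂ] H} (hK : IsSelfAdjoint K) {b : ℝ}
    (hb : b ∉ spectrum ℝ K) {m : ℕ} {e : Fin m → H} (he : Orthonormal ℂ e) {d : Fin m → ℝ}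
    (hd : Antitone d) {ε c : ℝ} (hcb : c < b) (hbd : ∀ j, b < d j - ε) (hε : 0 ≤ ε)
    (hL : ∀ a : Fin m → ℂ, ∑ j, (d j - ε) * ‖a j‖ ^ 2
      ≤ (inner ℂ (∑ j, a j • e j) (K (∑ j, a j • e j))).re)
    (hU : ∀ x, (inner ℂ x (K x)).re ≤ ∑ j, (d j + ε) * ‖inner ℂ (e j) x‖ ^ 2
      + c * (‖x‖ ^ 2 - ∑ j, ‖inner ℂ (e j) x‖ ^ 2)) :
    ∃ κ : Fin m → ℝ, IsUpperEigenvalueList K b κ ∧ ∀ j, |κ j - d j| ≤ ε := by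
  obtain ⟨q, c', hc'b, hq⟩ := exists_isUpperSpectralProjection hK hb
  have hqq : ∀ x, q (q x) = q x := fun x =>
    congrArg (fun A : H →L[ℂ] H => A x) hq.isStarProjection.isIdempotentElem.eq
  have hKq : ∀ x, q (K x) = K (q x) := fun x =>
    (congrArg (fun A : H →L[ℂ] H => A x) hq.commute.eq).symm
  have hqs : ∀ x y, inner ℂ (q x) y = inner ℂ x (q y) :=
    hq.isStarProjection.isSelfAdjoint.isSymmetric
  let M : Submodule ℂ H := LinearMap.range (q : H →ₗ[ℂ] H)
  have hM : ∀ x ∈ M, q x = x := by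
    rintro _ ⟨x, rfl⟩
    exact hqq x
  -- `dim M ≤ m`: a vector of `M` orthogonal to all `e j` would have form at most `c` and at least
  -- `b` times its squared norm.
  let φ : M →ₗ[ℂ] (Fin m → ℂ) :=
    LinearMap.pi fun j => (innerSL ℂ (e j) : H →ₗ[ℂ] ℂ) ∘ₗ M.subtype
  have hφi : Function.Injective φ := by
    rw [injective_iff_map_eq_zero]
    rintro ⟨x, hx⟩ h
    have h0 : ∀ j, inner ℂ (e j) x = 0 := fun j => congrFun h j
    have h1 := hU x
    have h2 := hq.lower x (hM x hx)
    simp only [h0, norm_zero, ne_eq, OfNat.ofNat_ne_zero, not_false_eq_true, zero_pow, mul_zero,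
      Finset.sum_const_zero, sub_zero, zero_add] at h1
    have h3 : ‖x‖ ^ 2 = 0 := by nlinarith [sq_nonneg ‖x‖]
    exact Subtype.ext (by simpa using h3)
  have : FiniteDimensional ℂ M := FiniteDimensional.of_injective φ hφi
  -- `dim M ≥ m`: a combination of the `e j` killed by `q` would have form at most `c'`, whereas the
  -- entries `d j - ε` exceed `b > c'`.
  let ψ : (Fin m → ℂ) →ₗ[ℂ] M :=
    (q : H →ₗ[ℂ] H).rangeRestrict ∘ₗ Fintype.linearCombination ℂ e
  have hψ : ∀ a, (ψ a : H) = q (∑ j, a j • e j) := fun _ => rfl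
  have hψi : Function.Injective ψ := by
    rw [injective_iff_map_eq_zero]
    intro a h
    have h0 : q (∑ j, a j • e j) = 0 := by rw [← hψ, h]; rfl
    have h1 := hL a
    have h2 := hq.upper _ h0
    rw [norm_sq_sum_smul_of_orthonormal he, Finset.mul_sum] at h2
    have h3 := h1.trans h2
    have h4 : ∑ j, ((d j - ε) - c') * ‖a j‖ ^ 2 ≤ 0 := by
      simp only [sub_mul _ c', Finset.sum_sub_distrib]
      linarith
    have h5 : ∀ j ∈ Finset.univ, 0 ≤ ((d j - ε) - c') * ‖a j‖ ^ 2 := fun j _ =>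
      mul_nonneg (by linarith [hbd j]) (sq_nonneg _)
    have h6 := (Finset.sum_eq_zero_iff_of_nonneg h5).1 (le_antisymm h4 (Finset.sum_nonneg h5))
    ext j
    have h7 := (mul_eq_zero.1 (h6 j (Finset.mem_univ j))).resolve_left (by linarith [hbd j])
    simpa using h7
  have hfin : Module.finrank ℂ M = m := by
    apply le_antisymm
    · simpa using LinearMap.finrank_le_finrank_of_injective hφi
    · simpa using LinearMap.finrank_le_finrank_of_injective hψi
  have hinv : ∀ x ∈ M, (K : H →ₗ[ℂ] H) x ∈ M := by
    rintro _ ⟨x, rfl⟩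
    exact ⟨K x, hKq x⟩
  obtain ⟨f, κ, hκa, hf, hfM, hκ, hfx⟩ := exists_orthonormal_eigenbasis hK.isSymmetric hfin hinv
  replace hκ : ∀ j, K (f j) = (κ j : ℂ) • f j := hκ
  have hqf : ∀ x, ∑ j, inner ℂ (f j) x • f j = q x := by
    intro x
    rw [← hfx (q x) ⟨x, rfl⟩]
    refine Finset.sum_congr rfl fun j _ => ?_
    rw [← hqs, hM _ (hfM j)]
  have hlist := hq.isUpperEigenvalueList hc'b hK hb hf hκ hqf
  refine ⟨κ, hlist, fun k => ?_⟩
  have hform : ∀ x, (inner ℂ (q x) (K (q x))).re = ∑ j, κ j * ‖inner ℂ (f j) x‖ ^ 2 := by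
    intro x
    rw [← hqf, map_sum]
    simp only [map_smul, hκ]
    have h1 := hf.inner_sum (fun j => inner ℂ (f j) x) (fun j => inner ℂ (f j) x * (κ j : ℂ))
      Finset.univ
    simp only [mul_smul] at h1
    rw [h1]
    rw [Complex.re_sum]
    refine Finset.sum_congr rfl fun j _ => ?_
    rw [← mul_assoc, mul_comm _ (inner ℂ (f j) x), Complex.mul_conj, ← Complex.ofReal_mul,
      Complex.ofReal_re, Complex.normSq_eq_norm_sq, mul_comm]
  have hsplit : ∀ x, (inner ℂ x (K x)).re
      = (inner ℂ (q x) (K (q x))).re + (inner ℂ (x - q x) (K (x - q x))).re := by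
    intro x
    have h1 : inner ℂ (q x) (K (x - q x)) = 0 := by
      rw [hqs, hKq, map_sub, hqq, sub_self, map_zero, inner_zero_right]
    have h2 : inner ℂ (x - q x) (K (q x)) = 0 := by
      rw [← hKq, ← hqs, map_sub, hqq, sub_self, inner_zero_left]
    have h3 : inner ℂ x (K x) = inner ℂ (q x + (x - q x)) (K (q x + (x - q x))) := by
      rw [add_sub_cancel]
    rw [h3, map_add, inner_add_left, inner_add_right, inner_add_right, h1, h2, add_zero, zero_add,
      Complex.add_re]
  have hnorm : ∀ x, ‖x - q x‖ ^ 2 = ‖x‖ ^ 2 - ∑ j, ‖inner ℂ (f j) x‖ ^ 2 := by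
    intro x
    have h1 : ‖q x‖ ^ 2 = ∑ j, ‖inner ℂ (f j) x‖ ^ 2 := by
      rw [← hqf, norm_sq_sum_smul_of_orthonormal hf]
    have h2 : inner ℂ (q x) (x - q x) = 0 := by
      rw [hqs, map_sub, hqq, sub_self, inner_zero_right]
    have h3 := norm_add_sq_eq_norm_sq_add_norm_sq_of_inner_eq_zero _ _ h2
    rw [add_sub_cancel] at h3
    rw [← h1]
    linarith
  -- Both inequalities are the same min-max comparison, with the eigenvectors `f` and the
  -- approximate ones `e` exchanging roles.
  rw [abs_sub_le_iff]
  constructor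
  · have h := le_of_form_le (g := fun x => (inner ℂ x (K x)).re) hf he hκa
      (β := fun j => d j + ε) (fun i j hij => add_le_add_left (hd hij) ε)
      (γ := c) (fun j => by linarith [hbd j]) ?_ hU k
    · linarith
    · intro a
      have h1 : q (∑ j, a j • f j) = ∑ j, a j • f j := by
        rw [map_sum]
        exact Finset.sum_congr rfl fun j _ => by rw [map_smul, hM _ (hfM j)]
      have h2 := hform (∑ j, a j • f j)
      rw [h1] at h2
      rw [h2]
      refine Finset.sum_le_sum fun j _ => ?_
      rw [hf.inner_right_fintype]
  · have h := le_of_form_le (g := fun x => (inner ℂ x (K x)).re) he hf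
      (α := fun j => d j - ε) (fun i j hij => sub_le_sub_right (hd hij) ε) hκa
      (γ := c') (fun j => by linarith [hlist.lt j]) hL ?_ k
    · linarith
    · intro x
      have h1 := hq.upper (x - q x) (by rw [map_sub, hqq, sub_self])
      rw [hsplit, hform]
      rw [hnorm] at h1
      linarith

/-- Sorting `d` reduces to the antitone case; undoing the permutation keeps each eigenvalue paired
with its own `d j`. -/
theorem exists_isUpperEigenvalueList {K : H →L[ℂ] H} (hK : IsSelfAdjoint K) {b : ℝ}
    (hb : b ∉ spectrum ℝ K) {m : ℕ} {e : Fin m → H} (he : Orthonormal ℂ e) {d : Fin m → ℝ}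
    {ε c : ℝ} (hcb : c < b) (hbd : ∀ j, b < d j - ε) (hε : 0 ≤ ε)
    (hL : ∀ a : Fin m → ℂ, ∑ j, (d j - ε) * ‖a j‖ ^ 2
      ≤ (inner ℂ (∑ j, a j • e j) (K (∑ j, a j • e j))).re)
    (hU : ∀ x, (inner ℂ x (K x)).re ≤ ∑ j, (d j + ε) * ‖inner ℂ (e j) x‖ ^ 2
      + c * (‖x‖ ^ 2 - ∑ j, ‖inner ℂ (e j) x‖ ^ 2)) :
    ∃ κ : Fin m → ℝ, IsUpperEigenvalueList K b κ ∧ ∀ j, |κ j - d j| ≤ ε := by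
  let σ : Equiv.Perm (Fin m) := Tuple.sort fun j => -d j
  have hσ : Antitone (d ∘ σ) := by
    intro i j hij
    have := Tuple.monotone_sort (fun j => -d j) hij
    simpa using this
  have hL' : ∀ a : Fin m → ℂ, ∑ j, ((d ∘ σ) j - ε) * ‖a j‖ ^ 2
      ≤ (inner ℂ (∑ j, a j • (e ∘ σ) j) (K (∑ j, a j • (e ∘ σ) j))).re := by
    intro a
    have h1 := hL (a ∘ σ.symm)
    rw [← Equiv.sum_comp σ, ← Equiv.sum_comp σ (fun j => (a ∘ σ.symm) j • e j)] at h1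
    simpa using h1
  have hU' : ∀ x, (inner ℂ x (K x)).re ≤ ∑ j, ((d ∘ σ) j + ε) * ‖inner ℂ ((e ∘ σ) j) x‖ ^ 2
      + c * (‖x‖ ^ 2 - ∑ j, ‖inner ℂ ((e ∘ σ) j) x‖ ^ 2) := by
    intro x
    have h1 := hU x
    rw [← Equiv.sum_comp σ, ← Equiv.sum_comp σ (fun j => ‖inner ℂ (e j) x‖ ^ 2)] at h1
    exact h1
  obtain ⟨κ, hκ, hd⟩ := exists_isUpperEigenvalueList_of_antitone hK hb
    (he.comp σ σ.injective) hσ hcb (fun j => hbd (σ j)) hε hL' hU'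
  refine ⟨κ ∘ σ.symm, hκ.comp_perm σ.symm, fun j => ?_⟩
  have := hd (σ.symm j)
  simpa using this

end UpperEigenvalues

/-! ### First-order perturbation of bounded self-adjoint operators. -/

section Perturbation

variable {H : Type*} [NormedAddCommGroup H] [InnerProductSpace ℂ H]

theorem re_inner_sum_of_diagonal {m : ℕ} {e : Fin m → H} {K' : H →L[ℂ] H} {ν : Fin m → ℝ}
    (hK' : ∀ i j, inner ℂ (e i) (K' (e j)) = if i = j then (ν j : ℂ) else 0) (a : Fin m → ℂ) :
    (inner ℂ (∑ j, a j • e j) (K' (∑ j, a j • e j))).re = ∑ j, ν j * ‖a j‖ ^ 2 := by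
  simp only [map_sum, map_smul, sum_inner, inner_sum, inner_smul_left, inner_smul_right, hK',
    mul_ite, mul_zero, Finset.sum_ite_eq', Finset.mem_univ, if_true]
  rw [Complex.re_sum]
  refine Finset.sum_congr rfl fun j _ => ?_
  rw [← mul_assoc, Complex.mul_conj, ← Complex.ofReal_mul, Complex.ofReal_re, Complex.normSq_eq_norm_sq, mul_comm]

theorem abs_re_inner_apply_le (B : H →L[ℂ] H) (x y : H) :
    |(inner ℂ x (B y)).re| ≤ ‖B‖ * ‖x‖ * ‖y‖ :=
  calc |(inner ℂ x (B y)).re| ≤ ‖inner ℂ x (B y)‖ := Complex.abs_re_le_norm _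
    _ ≤ ‖x‖ * ‖B y‖ := norm_inner_le_norm _ _
    _ ≤ ‖x‖ * (‖B‖ * ‖y‖) := by gcongr; exact B.le_opNorm y
    _ = ‖B‖ * ‖x‖ * ‖y‖ := by ring

variable [CompleteSpace H]

/-- Two-sided bounds for the quadratic form of a perturbation `K₁` of `K₀ + τ K'`. -/
theorem IsUpperSpectralProjection.form_bounds {K₀ q : H →L[ℂ] H} {b c : ℝ}
    (hq : IsUpperSpectralProjection K₀ q b c) {m : ℕ} {e : Fin m → H}
    (he : Orthonormal ℂ e) (hqe : ∀ x, ∑ j, inner ℂ (e j) x • e j = q x) {μ₀ : ℝ}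
    (hK₀ : ∀ j, K₀ (e j) = (μ₀ : ℂ) • e j) {K' : H →L[ℂ] H} {ν : Fin m → ℝ}
    (hK' : ∀ i j, inner ℂ (e i) (K' (e j)) = if i = j then (ν j : ℂ) else 0)
    (K₁ : H →L[ℂ] H) (τ : ℝ) {γ : ℝ} (hγ : 0 < γ) :
    (∀ a : Fin m → ℂ, ∑ j, (μ₀ + τ * ν j - (‖K₁ - K₀ - τ • K'‖ + τ ^ 2 * ‖K'‖ ^ 2 / γ)) * ‖a j‖ ^ 2
      ≤ (inner ℂ (∑ j, a j • e j) (K₁ (∑ j, a j • e j))).re) ∧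
    (∀ x, (inner ℂ x (K₁ x)).re ≤
      ∑ j, (μ₀ + τ * ν j + (‖K₁ - K₀ - τ • K'‖ + τ ^ 2 * ‖K'‖ ^ 2 / γ)) * ‖inner ℂ (e j) x‖ ^ 2
      + (c + γ + |τ| * ‖K'‖ + ‖K₁ - K₀ - τ • K'‖)
        * (‖x‖ ^ 2 - ∑ j, ‖inner ℂ (e j) x‖ ^ 2)) := by
  set B := K₁ - K₀ - τ • K' with hB
  have hdec : ∀ x, (inner ℂ x (K₁ x)).re
      = (inner ℂ x (K₀ x)).re + τ * (inner ℂ x (K' x)).re + (inner ℂ x (B x)).re := by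
    intro x
    have : K₁ x = K₀ x + (τ : ℂ) • K' x + B x := by
      rw [hB]; simp
    rw [this, inner_add_right, inner_add_right, inner_smul_right, Complex.add_re, Complex.add_re,
      Complex.re_ofReal_mul]
  have hBx : ∀ x, |(inner ℂ x (B x)).re| ≤ ‖B‖ * ‖x‖ ^ 2 := by
    intro x
    have := abs_re_inner_apply_le B x x
    rwa [mul_assoc, ← sq] at this
  have hKsum : ∀ a : Fin m → ℂ, K₀ (∑ j, a j • e j) = (μ₀ : ℂ) • ∑ j, a j • e j := by
    intro a
    rw [map_sum, Finset.smul_sum]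
    refine Finset.sum_congr rfl fun j _ => ?_
    rw [map_smul, hK₀, smul_comm]
  have hself : ∀ x : H, ((μ₀ : ℂ) * inner ℂ x x).re = μ₀ * ‖x‖ ^ 2 := by
    intro x
    rw [Complex.re_ofReal_mul]
    congr 1
    exact inner_self_eq_norm_sq (𝕜 := ℂ) x
  have hε : 0 ≤ τ ^ 2 * ‖K'‖ ^ 2 / γ := by positivity
  constructor
  · intro a
    have h1 := (abs_le.1 (hBx (∑ j, a j • e j))).1
    rw [hdec, hKsum, inner_smul_right, hself, re_inner_sum_of_diagonal hK',
      norm_sq_sum_smul_of_orthonormal he] at *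
    have h2 : ∑ j, (μ₀ + τ * ν j - (‖B‖ + τ ^ 2 * ‖K'‖ ^ 2 / γ)) * ‖a j‖ ^ 2
        = μ₀ * ∑ j, ‖a j‖ ^ 2 + τ * ∑ j, ν j * ‖a j‖ ^ 2
          - (‖B‖ + τ ^ 2 * ‖K'‖ ^ 2 / γ) * ∑ j, ‖a j‖ ^ 2 := by
      simp only [Finset.mul_sum, ← Finset.sum_add_distrib, ← Finset.sum_sub_distrib]
      exact Finset.sum_congr rfl fun j _ => by ring
    have h3 : 0 ≤ ∑ j, ‖a j‖ ^ 2 := Finset.sum_nonneg fun _ _ => sq_nonneg _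
    rw [h2]
    nlinarith [mul_nonneg hε h3]
  · intro x
    have hqq : ∀ x, q (q x) = q x := fun x =>
      congrArg (fun A : H →L[ℂ] H => A x) hq.isStarProjection.isIdempotentElem.eq
    have hKq : ∀ x, q (K₀ x) = K₀ (q x) := fun x =>
      (congrArg (fun A : H →L[ℂ] H => A x) hq.commute.eq).symm
    have hqs : ∀ x y, inner ℂ (q x) y = inner ℂ x (q y) :=
      hq.isStarProjection.isSelfAdjoint.isSymmetric
    set n := q x with hn
    obtain ⟨y, hy⟩ : ∃ y, y = x - n := ⟨_, rfl⟩
    have hqy : q y = 0 := by rw [hy, map_sub, hn, hqq, sub_self]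
    have hxy : x = n + y := by rw [hy]; abel
    have hnsum : n = ∑ j, inner ℂ (e j) x • e j := by rw [hqe]
    have hnn : ‖n‖ ^ 2 = ∑ j, ‖inner ℂ (e j) x‖ ^ 2 := by
      rw [hnsum, norm_sq_sum_smul_of_orthonormal he]
    have hKn : K₀ n = (μ₀ : ℂ) • n := by rw [hnsum, hKsum]
    have hny : inner ℂ n y = 0 := by rw [hn, hqs, hqy, inner_zero_right]
    have hyn : inner ℂ y n = 0 := by rw [hn, ← hqs, hqy, inner_zero_left]
    have hnKy : inner ℂ n (K₀ y) = 0 := by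
      rw [hn, hqs, hKq, hqy, map_zero, inner_zero_right]
    have hxx : ‖x‖ ^ 2 = ‖n‖ ^ 2 + ‖y‖ ^ 2 := by
      have := norm_add_sq_eq_norm_sq_add_norm_sq_of_inner_eq_zero _ _ hny
      rw [← hxy] at this
      linarith
    have hK₀x : (inner ℂ x (K₀ x)).re ≤ μ₀ * ‖n‖ ^ 2 + c * ‖y‖ ^ 2 := by
      have h1 : inner ℂ x (K₀ x) = (μ₀ : ℂ) * inner ℂ n n + inner ℂ y (K₀ y) := by
        rw [hxy, map_add, inner_add_left, inner_add_right, inner_add_right, hnKy, hKn,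
          inner_smul_right, inner_smul_right, hyn]
        simp
      rw [h1, Complex.add_re, hself]
      linarith [hq.upper y hqy]
    have hK'n : (inner ℂ n (K' n)).re = ∑ j, ν j * ‖inner ℂ (e j) x‖ ^ 2 := by
      rw [hnsum, re_inner_sum_of_diagonal hK']
    have hK'x : τ * (inner ℂ x (K' x)).re ≤ τ * (∑ j, ν j * ‖inner ℂ (e j) x‖ ^ 2)
        + (τ ^ 2 * ‖K'‖ ^ 2 / γ * ‖n‖ ^ 2 + γ * ‖y‖ ^ 2) + |τ| * ‖K'‖ * ‖y‖ ^ 2 := by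
      have h1 : (inner ℂ x (K' x)).re = (inner ℂ n (K' n)).re
          + ((inner ℂ n (K' y)).re + (inner ℂ y (K' n)).re) + (inner ℂ y (K' y)).re := by
        rw [hxy, map_add, inner_add_left, inner_add_right, inner_add_right]
        simp only [Complex.add_re]
        ring
      have h2 : τ * ((inner ℂ n (K' y)).re + (inner ℂ y (K' n)).re)
          ≤ |τ| * (2 * (‖K'‖ * ‖n‖ * ‖y‖)) := by
        refine (le_abs_self _).trans ?_
        rw [abs_mul]
        refine mul_le_mul_of_nonneg_left ((abs_add_le _ _).trans ?_) (abs_nonneg _)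
        have h3 := abs_re_inner_apply_le K' n y
        have h4 := abs_re_inner_apply_le K' y n
        linarith [mul_right_comm ‖K'‖ ‖y‖ ‖n‖]
      have h3 : τ * (inner ℂ y (K' y)).re ≤ |τ| * (‖K'‖ * ‖y‖ * ‖y‖) := by
        refine (le_abs_self _).trans ?_
        rw [abs_mul]
        exact mul_le_mul_of_nonneg_left (abs_re_inner_apply_le K' y y) (abs_nonneg _)
      -- Weighted Young inequality: the off-diagonal terms cost only `O(τ²)` on `ran q`, while the
      -- fixed cost `γ` falls on the complement, where the gap can absorb it.
      have h4 : |τ| * (2 * (‖K'‖ * ‖n‖ * ‖y‖))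
          ≤ τ ^ 2 * ‖K'‖ ^ 2 / γ * ‖n‖ ^ 2 + γ * ‖y‖ ^ 2 := by
        have h5 : 0 ≤ (|τ| * ‖K'‖ * ‖n‖ - γ * ‖y‖) ^ 2 / γ := by positivity
        have h6 : (|τ| * ‖K'‖ * ‖n‖ - γ * ‖y‖) ^ 2 / γ
            = τ ^ 2 * ‖K'‖ ^ 2 / γ * ‖n‖ ^ 2 + γ * ‖y‖ ^ 2 - |τ| * (2 * (‖K'‖ * ‖n‖ * ‖y‖)) := by
          rw [← sq_abs τ]
          field_simp
          ring
        linarith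
      rw [h1, hK'n, mul_add, mul_add]
      nlinarith
    have hBx' := (abs_le.1 (hBx x)).2
    have hsum : ∑ j, (μ₀ + τ * ν j + (‖B‖ + τ ^ 2 * ‖K'‖ ^ 2 / γ)) * ‖inner ℂ (e j) x‖ ^ 2
        = μ₀ * ‖n‖ ^ 2 + τ * ∑ j, ν j * ‖inner ℂ (e j) x‖ ^ 2
          + (‖B‖ + τ ^ 2 * ‖K'‖ ^ 2 / γ) * ‖n‖ ^ 2 := by
      rw [hnn]
      simp only [Finset.mul_sum, ← Finset.sum_add_distrib]
      exact Finset.sum_congr rfl fun j _ => by ring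
    rw [hdec, hsum, ← hnn, hxx]
    rw [hxx] at hBx'
    nlinarith

open Filter Asymptotics Topology in
/-- First-order perturbation of an isolated group of eigenvalues of bounded self-adjoint
operators. -/
theorem IsUpperSpectralProjection.exists_eigenvalue_branches {K : ℝ → H →L[ℂ] H} {s : Set ℝ}
    {t₀ : ℝ} (ht₀ : t₀ ∈ s) (hK : ∀ᶠ t in 𝓝[s] t₀, IsSelfAdjoint (K t)) {K' : H →L[ℂ] H}
    (hd : HasDerivWithinAt K K' s t₀) {q : H →L[ℂ] H} {b c : ℝ}
    (hq : IsUpperSpectralProjection (K t₀) q b c) (hcb : c < b) (hb : b ∉ spectrum ℝ (K t₀))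
    {m : ℕ} {e : Fin m → H} (he : Orthonormal ℂ e)
    (hqe : ∀ x, ∑ j, inner ℂ (e j) x • e j = q x) {μ₀ : ℝ} (hμ₀ : b < μ₀)
    (hK₀ : ∀ j, K t₀ (e j) = (μ₀ : ℂ) • e j) {ν : Fin m → ℝ}
    (hK' : ∀ i j, inner ℂ (e i) (K' (e j)) = if i = j then (ν j : ℂ) else 0) :
    ∃ κ : Fin m → ℝ → ℝ, (∀ᶠ t in 𝓝[s] t₀, IsUpperEigenvalueList (K t) b fun j => κ j t) ∧
      ∀ j, κ j t₀ = μ₀ ∧ HasDerivWithinAt (κ j) (ν j) s t₀ := by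
  -- Half the gap is given to the off-diagonal terms; the other half dominates the contributions
  -- that vanish as `t → t₀`.
  set γ := (b - c) / 2 with hγdef
  have hγ : 0 < γ := by rw [hγdef]; linarith
  let δ : ℝ → ℝ := fun t => ‖K t - K t₀ - (t - t₀) • K'‖
  let ε : ℝ → ℝ := fun t => δ t + (t - t₀) ^ 2 * ‖K'‖ ^ 2 / γ
  have hδo : δ =o[𝓝[s] t₀] fun t => t - t₀ := (hasDerivWithinAt_iff_isLittleO.1 hd).norm_left
  have hτ : Tendsto (fun t : ℝ => t - t₀) (𝓝[s] t₀) (𝓝 0) := by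
    have : Tendsto (fun t : ℝ => t - t₀) (𝓝 t₀) (𝓝 (t₀ - t₀)) :=
      (continuous_id.sub continuous_const).tendsto t₀
    rw [sub_self] at this
    exact this.mono_left nhdsWithin_le_nhds
  have hεo : ε =o[𝓝[s] t₀] fun t => t - t₀ := by
    refine hδo.add ?_
    have h1 : (fun t : ℝ => t - t₀) =o[𝓝[s] t₀] fun _ => (1 : ℝ) := (isLittleO_one_iff ℝ).2 hτ
    have h2 := (h1.mul_isBigO (isBigO_refl (fun t : ℝ => t - t₀) (𝓝[s] t₀))).const_mul_left
      (‖K'‖ ^ 2 / γ)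
    simp only [one_mul] at h2
    refine h2.congr_left fun t => by ring
  have hδ0 : Tendsto δ (𝓝[s] t₀) (𝓝 0) := hδo.trans_tendsto hτ
  have hε0 : Tendsto ε (𝓝[s] t₀) (𝓝 0) := hεo.trans_tendsto hτ
  have hev1 : ∀ᶠ t in 𝓝[s] t₀, b ∉ spectrum ℝ (K t) := by
    have h1 : ContinuousWithinAt (fun t => algebraMap ℝ (H →L[ℂ] H) b - K t) s t₀ :=
      continuousWithinAt_const.sub hd.continuousWithinAt
    have h2 : IsUnit (algebraMap ℝ (H →L[ℂ] H) b - K t₀) := spectrum.notMem_iff.1 hb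
    filter_upwards [h1.eventually (Units.isOpen.mem_nhds h2)] with t ht
    exact spectrum.notMem_iff.2 ht
  have hev2 : ∀ᶠ t in 𝓝[s] t₀, ∀ j, b < μ₀ + (t - t₀) * ν j - ε t := by
    rw [eventually_all]
    intro j
    have h1 : Tendsto (fun t => μ₀ + (t - t₀) * ν j - ε t) (𝓝[s] t₀) (𝓝 (μ₀ + 0 * ν j - 0)) :=
      (tendsto_const_nhds.add (hτ.mul_const _)).sub hε0
    exact h1.eventually (lt_mem_nhds (by simpa using hμ₀))
  have hev3 : ∀ᶠ t in 𝓝[s] t₀, c + γ + |t - t₀| * ‖K'‖ + δ t < b := by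
    have h1 : Tendsto (fun t => c + γ + |t - t₀| * ‖K'‖ + δ t) (𝓝[s] t₀)
        (𝓝 (c + γ + |0| * ‖K'‖ + 0)) :=
      (tendsto_const_nhds.add (hτ.abs.mul_const _)).add hδ0
    refine h1.eventually (gt_mem_nhds ?_)
    rw [abs_zero, zero_mul, hγdef]
    linarith
  have hev : ∀ᶠ t in 𝓝[s] t₀, ∃ κ : Fin m → ℝ, IsUpperEigenvalueList (K t) b κ ∧
      ∀ j, |κ j - (μ₀ + (t - t₀) * ν j)| ≤ ε t := by
    filter_upwards [hK, hev1, hev2, hev3] with t h0 h1 h2 h3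
    obtain ⟨hL, hU⟩ := hq.form_bounds he hqe hK₀ hK' (K t) (t - t₀) hγ
    exact exists_isUpperEigenvalueList h0 h1 he (d := fun j => μ₀ + (t - t₀) * ν j) h3 h2
      (by positivity) hL hU
  -- A list is chosen separately for each `t`, with value `0` where none exists. The bound by `ε t`
  -- alone gives differentiability at `t₀`.
  have hchoose : ∀ t, ∃ κ : Fin m → ℝ, (∃ κ : Fin m → ℝ, IsUpperEigenvalueList (K t) b κ ∧
      ∀ j, |κ j - (μ₀ + (t - t₀) * ν j)| ≤ ε t) → IsUpperEigenvalueList (K t) b κ ∧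
      ∀ j, |κ j - (μ₀ + (t - t₀) * ν j)| ≤ ε t := by
    intro t
    by_cases h : ∃ κ : Fin m → ℝ, IsUpperEigenvalueList (K t) b κ ∧
      ∀ j, |κ j - (μ₀ + (t - t₀) * ν j)| ≤ ε t
    · exact ⟨h.choose, fun _ => h.choose_spec⟩
    · exact ⟨0, fun h' => absurd h' h⟩
  choose κ hκ using hchoose
  have hκ0 : ∀ j, κ t₀ j = μ₀ := by
    intro j
    have h1 := (hκ t₀ (hev.self_of_nhdsWithin ht₀)).2 j
    have h2 : ε t₀ = 0 := by simp [ε, δ]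
    rw [h2, sub_self, zero_mul, add_zero] at h1
    exact sub_eq_zero.1 (abs_nonpos_iff.1 h1)
  refine ⟨fun j t => κ t j, ?_, fun j => ⟨hκ0 j, ?_⟩⟩
  · filter_upwards [hev] with t ht
    exact (hκ t ht).1
  · rw [hasDerivWithinAt_iff_isLittleO]
    refine IsBigO.trans_isLittleO (IsBigO.of_bound 1 ?_) hεo
    filter_upwards [hev] with t ht
    have h1 := (hκ t ht).2 j
    have h2 : κ t j - κ t₀ j - (t - t₀) • ν j = κ t j - (μ₀ + (t - t₀) * ν j) := by
      rw [hκ0, smul_eq_mul]; ring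
    rw [h2, one_mul, Real.norm_eq_abs, Real.norm_eq_abs]
    exact h1.trans (le_abs_self _)

end Perturbation

/-! ### The symplectic structure and Lagrangian projections. -/

section SymplecticForm

variable {𝔥 : Type*} [NormedAddCommGroup 𝔥] [InnerProductSpace ℂ 𝔥]

theorem symplecticForm_eq_inner (f g : WithLp 2 (𝔥 × 𝔥)) :
    symplecticForm f g = inner ℂ g (symplecticJ 𝔥 f) := by
  rw [WithLp.prod_inner_apply]
  simp [symplecticForm, symplecticJ, sub_eq_add_neg]

theorem symplecticJ_symplecticJ (f : WithLp 2 (𝔥 × 𝔥)) :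
    symplecticJ 𝔥 (symplecticJ 𝔥 f) = -f := by
  apply WithLp.ofLp_injective
  ext <;> simp [symplecticJ]

theorem inner_symplecticJ_left (f g : WithLp 2 (𝔥 × 𝔥)) :
    inner ℂ (symplecticJ 𝔥 f) g = -inner ℂ f (symplecticJ 𝔥 g) := by
  rw [WithLp.prod_inner_apply, WithLp.prod_inner_apply]
  simp [symplecticJ]

theorem inner_symplecticJ_eq_zero_of_lagrangian
    {Q : WithLp 2 (𝔥 × 𝔥) →L[ℂ] WithLp 2 (𝔥 × 𝔥)} (hL : IsLagrangian (Set.range Q))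
    (f g : WithLp 2 (𝔥 × 𝔥)) : inner ℂ (Q f) (symplecticJ 𝔥 (Q g)) = 0 := by
  have h : Q g ∈ Set.range Q := ⟨g, rfl⟩
  rw [hL] at h
  rw [← symplecticForm_eq_inner]
  exact h _ ⟨f, rfl⟩

variable [CompleteSpace 𝔥]

/-- For a Lagrangian range, `J` exchanges `ran Q` and its orthogonal complement. Isotropy gives `Q J
Q = 0`, maximality gives `Q J (1 - Q) = J (1 - Q)`, and these add up to the identity. -/
theorem symplecticJ_projection_add {Q : WithLp 2 (𝔥 × 𝔥) →L[ℂ] WithLp 2 (𝔥 × 𝔥)}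
    (hQ : IsStarProjection Q) (hL : IsLagrangian (Set.range Q)) :
    Q * symplecticJ 𝔥 + symplecticJ 𝔥 * Q = symplecticJ 𝔥 := by
  have hQQ : ∀ x, Q (Q x) = Q x := fun x =>
    congrArg (fun A : WithLp 2 (𝔥 × 𝔥) →L[ℂ] WithLp 2 (𝔥 × 𝔥) => A x) hQ.isIdempotentElem.eq
  have hQs : ∀ x y, inner ℂ (Q x) y = inner ℂ x (Q y) := hQ.isSelfAdjoint.isSymmetric
  have h1 : ∀ f, Q (symplecticJ 𝔥 (Q f)) = 0 := by
    intro f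
    refine ext_inner_left ℂ fun g => ?_
    rw [← hQs, inner_symplecticJ_eq_zero_of_lagrangian hL, inner_zero_right]
  have h2 : ∀ f, Q (symplecticJ 𝔥 (f - Q f)) = symplecticJ 𝔥 (f - Q f) := by
    intro f
    have h : symplecticJ 𝔥 (f - Q f) ∈ Set.range Q := by
      rw [hL]
      rintro _ ⟨g, rfl⟩
      rw [symplecticForm_eq_inner, symplecticJ_symplecticJ, inner_neg_right, hQs, map_sub, hQQ,
        sub_self, inner_zero_right, neg_zero]
    obtain ⟨g, hg⟩ := h
    rw [← hg, hQQ]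
  ext1 f
  have h3 := h2 f
  rw [map_sub, map_sub, h1, sub_zero] at h3
  rw [add_apply, mul_apply_eq_comp, mul_apply_eq_comp, h3, sub_add_cancel]

end SymplecticForm

/-! ### Differentiating identities along the parameter interval. -/

section Derivatives

variable {X : Type*} [NormedAddCommGroup X] [NormedSpace ℂ X] {t₀ : ℝ}

theorem hasParamDeriv_unique (ht₀ : t₀ ∈ Set.Icc (0 : ℝ) 1) {F G : ℝ → X} {dF dG : X}
    (hF : HasParamDeriv F dF t₀) (hG : HasParamDeriv G dG t₀)
    (h : ∀ t ∈ Set.Icc (0 : ℝ) 1, F t = G t) : dF = dG :=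
  (uniqueDiffOn_Icc one_pos t₀ ht₀).eq_deriv _ hF
    (HasDerivWithinAt.congr hG h (h t₀ ht₀))

theorem HasParamDeriv.clm_comp {Y : Type*} [NormedAddCommGroup Y] [NormedSpace ℂ Y]
    {F : ℝ → X} {dF : X} (hF : HasParamDeriv F dF t₀) (L : X →L[ℂ] Y) :
    HasParamDeriv (fun t => L (F t)) (L dF) t₀ :=
  (L.restrictScalars ℝ).hasFDerivAt.comp_hasDerivWithinAt t₀ hF

theorem HasParamDeriv.clm_apply_const {Y : Type*} [NormedAddCommGroup Y] [NormedSpace ℂ Y]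
    {F : ℝ → X →L[ℂ] Y} {dF : X →L[ℂ] Y} (hF : HasParamDeriv F dF t₀) (x : X) :
    HasParamDeriv (fun t => F t x) (dF x) t₀ :=
  hF.clm_comp (ContinuousLinearMap.apply ℂ Y x)

variable {W : Type*} [NormedAddCommGroup W] [InnerProductSpace ℂ W]

theorem HasParamDeriv.inner {f g : ℝ → W} {df dg : W} (hf : HasParamDeriv f df t₀)
    (hg : HasParamDeriv g dg t₀) :
    HasParamDeriv (fun t => inner ℂ (f t) (g t))
      (inner ℂ (f t₀) dg + inner ℂ df (g t₀)) t₀ :=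
  HasDerivWithinAt.inner ℂ hf hg

theorem inner_deriv_comm_of_isSelfAdjoint [CompleteSpace W] (ht₀ : t₀ ∈ Set.Icc (0 : ℝ) 1)
    {F : ℝ → W →L[ℂ] W} {dF : W →L[ℂ] W} (hF : HasParamDeriv F dF t₀)
    (h : ∀ t ∈ Set.Icc (0 : ℝ) 1, IsSelfAdjoint (F t)) (x y : W) :
    inner ℂ (dF x) y = inner ℂ x (dF y) := by
  have h1 := (hF.clm_apply_const x).inner (g := fun _ => y) (hasDerivWithinAt_const _ _ _)
  have h2 := HasParamDeriv.inner (f := fun _ => x) (hasDerivWithinAt_const _ _ _)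
    (hF.clm_apply_const y)
  have h3 := hasParamDeriv_unique ht₀ h1 h2 fun t ht => (h t ht).isSymmetric x y
  simpa using h3

theorem inner_deriv_add_eq_zero (ht₀ : t₀ ∈ Set.Icc (0 : ℝ) 1) {T : ℝ → X →L[ℂ] W}
    {dT : X →L[ℂ] W} (hT : HasParamDeriv T dT t₀) (J : W →L[ℂ] W) (u v : X)
    (h : ∀ t ∈ Set.Icc (0 : ℝ) 1, inner ℂ (T t v) (J (T t u)) = inner ℂ (T t₀ v) (J (T t₀ u))) :
    inner ℂ (T t₀ v) (J (dT u)) + inner ℂ (dT v) (J (T t₀ u)) = 0 :=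
  hasParamDeriv_unique ht₀
    ((hT.clm_apply_const v).inner ((hT.clm_apply_const u).clm_comp J))
    (hasDerivWithinAt_const _ _ (inner ℂ (T t₀ v) (J (T t₀ u)))) h

end Derivatives

/-! ### Green identity and the resolvent difference formula. -/

section Family

variable {H : Type*} [NormedAddCommGroup H] [InnerProductSpace ℂ H] [CompleteSpace H]
  {𝔥 : Type*} [NormedAddCommGroup 𝔥] [InnerProductSpace ℂ 𝔥]
  {D : Type*} [NormedAddCommGroup D] [NormedSpace ℂ D]
  {A : H →ₗ.[ℂ] H} {ι : D →L[ℂ] H}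

theorem IsTraceDomain.mem_adjoint_domain (hι : IsTraceDomain A ι) (u : D) :
    ι u ∈ A.adjoint.domain := hι.core.le_domain ⟨u, rfl⟩

theorem le_adjoint_of_isSelfAdjoint (hA : Dense (A.domain : Set H)) {E : H →ₗ.[ℂ] H}
    (hE : IsSelfAdjoint E) (hAE : A ≤ E) : E ≤ A.adjoint := by
  refine LinearPMap.IsFormalAdjoint.le_adjoint hA fun x y => ?_
  have h1 := isFormalAdjoint_of_isSelfAdjoint hE ⟨x, hAE.1 x.2⟩ y
  rw [← hAE.2 (x := x) (y := ⟨x, hAE.1 x.2⟩) rfl] at h1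
  exact h1

/-- The left side of the Green identity involves only `A*`, so `ω(T t u, T t v)` does not depend on
`t`, and its derivative vanishes. -/
theorem symplecticForm_deriv_add (hι : IsTraceDomain A ι) {t₀ : ℝ}
    (ht₀ : t₀ ∈ Set.Icc (0 : ℝ) 1) {T : ℝ → D →L[ℂ] WithLp 2 (𝔥 × 𝔥)}
    (htr : ∀ t ∈ Set.Icc (0 : ℝ) 1, IsTraceOperator A ι (T t))
    {dT : D →L[ℂ] WithLp 2 (𝔥 × 𝔥)} (hT : HasParamDeriv T dT t₀) (u v : D) :
    inner ℂ (T t₀ v) (symplecticJ 𝔥 (dT u)) + inner ℂ (dT v) (symplecticJ 𝔥 (T t₀ u)) = 0 := by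
  refine inner_deriv_add_eq_zero ht₀ hT (symplecticJ 𝔥) u v fun t ht => ?_
  rw [← symplecticForm_eq_inner, ← symplecticForm_eq_inner,
    ← (htr t ht).green u v (hι.mem_adjoint_domain u) (hι.mem_adjoint_domain v),
    ← (htr t₀ ht₀).green u v (hι.mem_adjoint_domain u) (hι.mem_adjoint_domain v)]

variable [CompleteSpace 𝔥]

theorem IsAdmissible.projection_trace {T : D →L[ℂ] WithLp 2 (𝔥 × 𝔥)}
    {Q : WithLp 2 (𝔥 × 𝔥) →L[ℂ] WithLp 2 (𝔥 × 𝔥)} {E : H →ₗ.[ℂ] H} {V : H →L[ℂ] H}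
    (h : IsAdmissible A ι T Q E V) {u : D} (hu : ι u ∈ E.domain) : Q (T u) = T u := by
  have h1 : T u ∈ Set.range Q := by
    rw [← h.closure_trace]
    exact subset_closure ⟨u, hu, rfl⟩
  obtain ⟨w, hw⟩ := h1
  rw [← hw]
  exact congrArg (fun A : WithLp 2 (𝔥 × 𝔥) →L[ℂ] WithLp 2 (𝔥 × 𝔥) => A w)
    h.projection.isIdempotentElem.eq

/-- The derivative of `Q J + J Q = J`, whose right side is constant. -/
theorem projection_deriv_symplecticJ {t₀ : ℝ} (ht₀ : t₀ ∈ Set.Icc (0 : ℝ) 1)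
    {Q : ℝ → WithLp 2 (𝔥 × 𝔥) →L[ℂ] WithLp 2 (𝔥 × 𝔥)}
    (hQ : ∀ t ∈ Set.Icc (0 : ℝ) 1, IsStarProjection (Q t))
    (hL : ∀ t ∈ Set.Icc (0 : ℝ) 1, IsLagrangian (Set.range (Q t)))
    {dQ : WithLp 2 (𝔥 × 𝔥) →L[ℂ] WithLp 2 (𝔥 × 𝔥)} (hd : HasParamDeriv Q dQ t₀)
    (f : WithLp 2 (𝔥 × 𝔥)) : symplecticJ 𝔥 (dQ f) = -dQ (symplecticJ 𝔥 f) := by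
  have h1 : HasParamDeriv (fun t => symplecticJ 𝔥 (Q t f)) (symplecticJ 𝔥 (dQ f)) t₀ :=
    (hd.clm_apply_const f).clm_comp (symplecticJ 𝔥)
  have h2 : HasParamDeriv (fun t => Q t (symplecticJ 𝔥 f) + symplecticJ 𝔥 (Q t f))
      (dQ (symplecticJ 𝔥 f) + symplecticJ 𝔥 (dQ f)) t₀ :=
    HasDerivWithinAt.add (hd.clm_apply_const (symplecticJ 𝔥 f)) h1
  have h3 := hasParamDeriv_unique ht₀ h2
    (hasDerivWithinAt_const _ _ (symplecticJ 𝔥 f)) fun t ht =>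
      congrArg (fun B : WithLp 2 (𝔥 × 𝔥) →L[ℂ] WithLp 2 (𝔥 × 𝔥) => B f)
        (symplecticJ_projection_add (hQ t ht) (hL t ht))
  exact eq_neg_of_add_eq_zero_right h3

/-- The difference of the resolvents of two admissible operators, in terms of the differences of
traces, projections and potentials. -/
theorem resolvent_sub_eq (hA : Dense (A.domain : Set H)) (hι : IsTraceDomain A ι)
    {T T' : D →L[ℂ] WithLp 2 (𝔥 × 𝔥)} {Q Q' : WithLp 2 (𝔥 × 𝔥) →L[ℂ] WithLp 2 (𝔥 × 𝔥)}
    {E E' : H →ₗ.[ℂ] H} {V V' : H →L[ℂ] H} (h : IsAdmissible A ι T Q E V)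
    (h' : IsAdmissible A ι T' Q' E' V') {a : ℝ} {ρ ρ' : H →L[ℂ] D}
    (hρ : IsResolventInto ι (perturbed E V) a ρ)
    (hρ' : IsResolventInto ι (perturbed E' V') a ρ') :
    ι ∘L ρ' - ι ∘L ρ =
      ContinuousLinearMap.adjoint ((Q' - Q) ∘L T ∘L ρ) ∘L (symplecticJ 𝔥 ∘L T' ∘L ρ')
      - ContinuousLinearMap.adjoint ((T' - T) ∘L ρ) ∘L (symplecticJ 𝔥 ∘L T' ∘L ρ')
      - ContinuousLinearMap.adjoint (ι ∘L ρ) ∘L (V' - V) ∘L (ι ∘L ρ') := by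
  ext f
  refine ext_inner_left ℂ fun g => ?_
  have hR : IsSelfAdjoint (ι ∘L ρ) :=
    hρ.toHilbert.isSelfAdjoint (perturbed_isFormalAdjoint
      (isFormalAdjoint_of_isSelfAdjoint h.selfAdjoint) h.potential)
  have hRs : inner ℂ g (ι (ρ f)) = inner ℂ (ι (ρ g)) f := (hR.isSymmetric g f).symm
  obtain ⟨x, hxdef, hx, ex⟩ : ∃ x, ρ' f = x ∧ ∃ hx : ι x ∈ (perturbed E' V').domain,
    perturbed E' V' ⟨ι x, hx⟩ - (a : ℂ) • ι x = f := ⟨_, rfl, hρ'.1 f⟩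
  obtain ⟨y, hydef, hy, ey⟩ : ∃ y, ρ g = y ∧ ∃ hy : ι y ∈ (perturbed E V).domain,
    perturbed E V ⟨ι y, hy⟩ - (a : ℂ) • ι y = g := ⟨_, rfl, hρ.1 g⟩
  have hEx : E' ⟨ι x, hx⟩ = A.adjoint ⟨ι x, hι.mem_adjoint_domain x⟩ :=
    (le_adjoint_of_isSelfAdjoint hA h'.selfAdjoint h'.extends_op).2 rfl
  have hEy : E ⟨ι y, hy⟩ = A.adjoint ⟨ι y, hι.mem_adjoint_domain y⟩ :=
    (le_adjoint_of_isSelfAdjoint hA h.selfAdjoint h.extends_op).2 rfl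
  rw [perturbed_apply] at ex ey
  rw [hEx] at ex
  rw [hEy] at ey
  have hgreen := h'.trace.green x y (hι.mem_adjoint_domain x) (hι.mem_adjoint_domain y)
  rw [symplecticForm_eq_inner] at hgreen
  have hV : inner ℂ (V (ι y)) (ι x) = inner ℂ (ι y) (V (ι x)) := h.potential.isSymmetric _ _
  have h1 : inner ℂ g (ι x) - inner ℂ (ι y) f
      = -inner ℂ (T' y) (symplecticJ 𝔥 (T' x)) - inner ℂ (ι y) ((V' - V) (ι x)) := by
    rw [← hgreen]
    nth_rewrite 1 [← ey]
    nth_rewrite 1 [← ex]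
    simp only [inner_sub_left, inner_sub_right, inner_add_left, inner_add_right, inner_smul_left,
      inner_smul_right, Complex.conj_ofReal, hV, sub_apply]
    ring
  have hTx : Q' (T' x) = T' x := h'.projection_trace hx
  have hTy : Q (T y) = T y := h.projection_trace hy
  -- `Q' (T y)` and `T' x` both lie in the Lagrangian range of `Q'`, so only `T y - Q' (T y) = -(Q'
  -- - Q)(T y)` contributes. This puts a difference of projections into the boundary term.
  have h2 : inner ℂ (T y) (symplecticJ 𝔥 (T' x))
      = -inner ℂ ((Q' - Q) (T y)) (symplecticJ 𝔥 (T' x)) := by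
    have h3 := inner_symplecticJ_eq_zero_of_lagrangian h'.lagrangian (T y) (T' x)
    rw [hTx] at h3
    rw [sub_apply, hTy, inner_sub_left, h3]
    ring
  have h4 : inner ℂ (T' y) (symplecticJ 𝔥 (T' x))
      = inner ℂ ((T' - T) y) (symplecticJ 𝔥 (T' x))
        - inner ℂ ((Q' - Q) (T y)) (symplecticJ 𝔥 (T' x)) := by
    rw [sub_eq_add_neg, ← h2, sub_apply, inner_sub_left]
    ring
  simp only [sub_apply, ContinuousLinearMap.comp_apply, inner_sub_right,
    ContinuousLinearMap.adjoint_inner_right]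
  rw [hRs, hxdef, hydef, h1, h4]
  simp only [sub_apply, inner_sub_right]
  ring

end Family

/-! ### The Riesz projection as a spectral projection of a resolvent. -/

section RieszProjection

variable {H : Type*} [NormedAddCommGroup H] [InnerProductSpace ℂ H] [CompleteSpace H]
  {D : Type*} [NormedAddCommGroup D] [NormedSpace ℂ D] [CompleteSpace D]

/-- The form of `R` on `ker q` is at most `c < b = 1/(2r)`, so the operator has real part at least
`1/2` and is invertible. This supplies invertibility at the centre of the disc. -/
theorem isUnit_one_sub_smul_of_upper {R q : H →L[ℂ] H} {b c : ℝ}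
    (hq : IsUpperSpectralProjection R q b c) {r : ℝ} (hr : 0 < r) (hrb : r * b = 1 / 2)
    (hcb : c < b) : IsUnit (1 - (r : ℂ) • (R * (1 - q))) := by
  refine ContinuousLinearMap.isUnit_of_forall_le_norm_inner_map _ (c := 1 / 2) (by norm_num)
    fun x => ?_
  have hqq : ∀ x, q (q x) = q x := fun x =>
    congrArg (fun A : H →L[ℂ] H => A x) hq.isStarProjection.isIdempotentElem.eq
  have hRq : ∀ x, q (R x) = R (q x) := fun x =>
    (congrArg (fun A : H →L[ℂ] H => A x) hq.commute.eq).symm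
  have hqs : ∀ x y, inner ℂ (q x) y = inner ℂ x (q y) :=
    hq.isStarProjection.isSelfAdjoint.isSymmetric
  obtain ⟨y, hy⟩ : ∃ y, y = x - q x := ⟨_, rfl⟩
  have hqy : q y = 0 := by rw [hy, map_sub, hqq, sub_self]
  have hxy : x = q x + y := by rw [hy]; abel
  have h1 : inner ℂ x (R y) = inner ℂ y (R y) := by
    nth_rewrite 1 [hxy]
    rw [inner_add_left, hqs, hRq, hqy, map_zero, inner_zero_right, zero_add]
  have h2 : ‖y‖ ^ 2 ≤ ‖x‖ ^ 2 := by
    have h3 : inner ℂ (q x) y = 0 := by rw [hqs, hqy, inner_zero_right]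
    have h4 := norm_add_sq_eq_norm_sq_add_norm_sq_of_inner_eq_zero _ _ h3
    rw [← hxy] at h4
    nlinarith [sq_nonneg ‖q x‖]
  have h5 : (inner ℂ x ((1 - (r : ℂ) • (R * (1 - q))) x)).re
      = ‖x‖ ^ 2 - r * (inner ℂ y (R y)).re := by
    have h6 : (1 - (r : ℂ) • (R * (1 - q))) x = x - (r : ℂ) • R y := by
      rw [hy]; rfl
    rw [h6, inner_sub_right, inner_smul_right, h1, Complex.sub_re, Complex.re_ofReal_mul]
    congr 1
    exact inner_self_eq_norm_sq (𝕜 := ℂ) x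
  have h7 := mul_le_mul_of_nonneg_left (hq.upper y hqy) hr.le
  have h8 : r * (c * ‖y‖ ^ 2) ≤ 1 / 2 * ‖x‖ ^ 2 := by
    have : r * c ≤ 1 / 2 := by rw [← hrb]; exact mul_le_mul_of_nonneg_left hcb.le hr.le
    nlinarith [sq_nonneg ‖y‖, mul_le_mul_of_nonneg_right this (sq_nonneg ‖y‖)]
  rw [norm_inner_symm]
  refine le_trans ?_ (Complex.re_le_norm _)
  rw [h5]
  push_cast
  linarith

theorem commute_ringInverse_right {A : Type*} [Ring A] {a b : A} (h : Commute a b)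
    (hb : IsUnit b) : Commute a (Ring.inverse b) := by
  obtain ⟨u, rfl⟩ := hb
  rw [Ring.inverse_unit]
  exact h.units_inv_right

/-- `W` agrees with `U` on the `p` part and is the identity on the other part, and both commute with
`p`. So `W` can replace `U` behind `p`, even though `W` may be invertible where `U` is not. -/
theorem mul_ringInverse_eq_of_compression {A : Type*} [Ring A] {p U W : A} (hp : Commute p U)
    (hpp : p * p = p) (hW : W = U * p + (1 - p)) (hWu : IsUnit W) (hU : IsUnit U) :
    p * Ring.inverse U = p * Ring.inverse W := by
  have hpW : p * W = p * U := by
    rw [hW, mul_add, mul_sub, mul_one, hpp, sub_self, add_zero, ← mul_assoc, hp.eq, mul_assoc, hpp]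
  have hcW : Commute p W := by
    rw [hW]
    exact (hp.mul_right (Commute.refl p)).add_right ((Commute.one_right p).sub_right (Commute.refl p))
  calc p * Ring.inverse U = Ring.inverse W * W * (p * Ring.inverse U) := by
        rw [Ring.inverse_mul_cancel _ hWu, one_mul]
    _ = Ring.inverse W * (p * U) * Ring.inverse U := by
        rw [← hpW, hcW.eq]
        simp only [mul_assoc]
    _ = p * Ring.inverse W := by
        rw [mul_assoc, mul_assoc, Ring.mul_inverse_cancel _ hU, mul_one]
        exact (commute_ringInverse_right hcW hWu).eq.symm

/-- The Riesz projection of an operator with resolvent `R` at `lam - r` is the spectral projection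
of `R` at the point `1 / r`. -/
theorem comp_rieszProjection {ι : D →L[ℂ] H} (hι : Function.Injective ι) {S : H →ₗ.[ℂ] H}
    {lam r : ℝ} (hr : 0 < r) {ρ : H →L[ℂ] D} (hρ : IsResolventInto ι S ((lam - r : ℝ) : ℂ) ρ)
    {q : H →L[ℂ] H} (hqq : q * q = q) (hcomm : Commute (ι ∘L ρ) q)
    (hRq : (r : ℂ) • ((ι ∘L ρ) * q) = q)
    (hres : ∀ z ∈ Metric.closedBall (lam : ℂ) r, z ≠ lam → z ∈ resolventSet S)
    (hunit : IsUnit (1 - (r : ℂ) • ((ι ∘L ρ) * (1 - q)))) :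
    ι ∘L rieszProjection ι S lam r = q := by
  set R := ι ∘L ρ with hR
  let a : ℂ := ((lam - r : ℝ) : ℂ)
  have ha : a = lam - r := by simp [a]
  let U : ℂ → H →L[ℂ] H := fun z => 1 + (a - z) • R
  -- `U` degenerates on `ran q` at `z = lam`; removing that part makes `W` invertible on the whole
  -- closed disc.
  let W : ℂ → H →L[ℂ] H := fun z => 1 + (a - z) • (R * (1 - q))
  have hU : ∀ z ∈ Metric.closedBall (lam : ℂ) r, z ≠ lam → IsUnit (U z) := fun z hz hzl =>
    (hρ.toHilbert.mem_resolventSet_iff z).1 (hres z hz hzl)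
  have hp : (1 - q) * (1 - q) = 1 - q := by
    rw [mul_sub, sub_mul, sub_mul, hqq]; simp
  have hWU : ∀ z, W z = U z * (1 - q) + (1 - (1 - q)) := by
    intro z
    simp only [W, U, add_mul, one_mul, smul_mul_assoc]
    abel
  have hcU : ∀ z, Commute (1 - q) (U z) := fun z =>
    (Commute.one_left _).sub_left ((Commute.one_right q).add_right (hcomm.symm.smul_right _))
  have hW : ∀ z ∈ Metric.closedBall (lam : ℂ) r, IsUnit (W z) := by
    intro z hz
    by_cases hzl : z = lam
    · have : W z = 1 - (r : ℂ) • (R * (1 - q)) := by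
        simp only [W]
        rw [hzl, ha, sub_sub_cancel_left, neg_smul, ← sub_eq_add_neg]
      rw [this]
      exact hunit
    · have hu := hU z hz hzl
      have hci : Commute (1 - q) (Ring.inverse (U z)) := commute_ringInverse_right (hcU z) hu
      refine isUnit_iff_exists.2 ⟨Ring.inverse (U z) * (1 - q) + (1 - (1 - q)), ?_, ?_⟩
      · rw [hWU]
        have h1 : U z * (1 - q) * (Ring.inverse (U z) * (1 - q)) = 1 - q := by
          rw [mul_assoc, ← mul_assoc (1 - q), hci.eq, mul_assoc, hp, ← mul_assoc,
            Ring.mul_inverse_cancel _ hu, one_mul]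
        have h2 : U z * (1 - q) * (1 - (1 - q)) = 0 := by
          rw [mul_assoc, mul_sub, mul_one, hp, sub_self, mul_zero]
        have h3 : (1 - (1 - q)) * (Ring.inverse (U z) * (1 - q)) = 0 := by
          rw [← hci.eq, ← mul_assoc, sub_mul, one_mul, hp, sub_self, zero_mul]
        have h4 : (1 - (1 - q)) * (1 - (1 - q)) = 1 - (1 - q) := by
          rw [sub_sub_cancel, hqq]
        rw [add_mul, mul_add, mul_add, h1, h2, h3, h4]
        abel
      · rw [hWU]
        have h1 : Ring.inverse (U z) * (1 - q) * (U z * (1 - q)) = 1 - q := by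
          rw [mul_assoc, ← mul_assoc (1 - q), (hcU z).eq, mul_assoc, hp, ← mul_assoc,
            Ring.inverse_mul_cancel _ hu, one_mul]
        have h2 : Ring.inverse (U z) * (1 - q) * (1 - (1 - q)) = 0 := by
          rw [mul_assoc, mul_sub, mul_one, hp, sub_self, mul_zero]
        have h3 : (1 - (1 - q)) * (U z * (1 - q)) = 0 := by
          rw [← (hcU z).eq, ← mul_assoc, sub_mul, one_mul, hp, sub_self, zero_mul]
        have h4 : (1 - (1 - q)) * (1 - (1 - q)) = 1 - (1 - q) := by
          rw [sub_sub_cancel, hqq]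
        rw [add_mul, mul_add, mul_add, h1, h2, h3, h4]
        abel
  have hsphere : ∀ z ∈ Metric.sphere (lam : ℂ) r,
      z ∈ Metric.closedBall (lam : ℂ) r ∧ z ≠ lam := by
    intro z hz
    refine ⟨Metric.sphere_subset_closedBall hz, ?_⟩
    rintro rfl
    rw [Metric.mem_sphere, dist_self] at hz
    exact hr.ne hz
  have hUcont : Continuous U := by fun_prop
  have hWdiff : Differentiable ℂ W := by fun_prop
  have hresolv : Set.EqOn (fun z => resolventInto ι S z) (fun z => ρ ∘L Ring.inverse (U z))
      (Metric.sphere (lam : ℂ) r) := by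
    intro z hz
    have hu := hU z (hsphere z hz).1 (hsphere z hz).2
    have e : U z = 1 + (0 + (a - z) • 1) * (ι ∘L ρ) := by simp [U, hR]
    have h1 : IsResolventInto ι S z (ρ ∘L Ring.inverse (U z)) := by
      have h2 := hρ.perturb_inverse 0 z (by rw [← e]; exact hu)
      rw [perturbed_zero] at h2
      rw [e]
      exact h2
    exact h1.resolventInto_eq hι
  have hinvcont : ContinuousOn (fun z => Ring.inverse (U z)) (Metric.sphere (lam : ℂ) r) := by
    intro z hz
    obtain ⟨u, hu⟩ := hU z (hsphere z hz).1 (hsphere z hz).2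
    have h1 := NormedRing.inverse_continuousAt u
    rw [hu] at h1
    exact (h1.comp hUcont.continuousAt).continuousWithinAt
  have hint : CircleIntegrable (fun z => ρ ∘L Ring.inverse (U z)) lam r :=
    ContinuousOn.circleIntegrable hr.le (continuousOn_const.clm_comp hinvcont)
  let L : (H →L[ℂ] D) →L[ℂ] (H →L[ℂ] H) := ContinuousLinearMap.compL ℂ H D H ι
  have hL : ι ∘L circleIntegral (fun z => ρ ∘L Ring.inverse (U z)) lam r
      = circleIntegral (fun z => R * Ring.inverse (U z)) lam r := by
    have h1 := L.intervalIntegral_comp_comm hint.out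
    rw [circleIntegral, circleIntegral]
    refine Eq.trans h1.symm ?_
    simp only [map_smul]
    rfl
  -- On `ran q` one has `R = 1/r`, so the resolvent there is `-(z - lam)⁻¹`. The remaining part is
  -- analytic inside the circle and integrates to zero.
  have hdec : Set.EqOn (fun z => R * Ring.inverse (U z))
      (fun z => R * ((1 - q) * Ring.inverse (W z)) - (z - lam)⁻¹ • q)
      (Metric.sphere (lam : ℂ) r) := by
    intro z hz
    have hzl := (hsphere z hz).2
    have hu := hU z (hsphere z hz).1 hzl
    have hr0 : (r : ℂ) ≠ 0 := by exact_mod_cast hr.ne'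
    have hzl' : z - lam ≠ 0 := sub_ne_zero.2 hzl
    have h1 := mul_ringInverse_eq_of_compression (hcU z) hp (hWU z) (hW z (hsphere z hz).1) hu
    have h2 : R * q = (r : ℂ)⁻¹ • q := by
      nth_rewrite 2 [← hRq]
      rw [smul_smul, inv_mul_cancel₀ hr0, one_smul]
    have h3 : R * q * Ring.inverse (U z) = -((z - lam)⁻¹ • q) := by
      have h4 : R * q = -((z - lam)⁻¹ • q) * U z := by
        have h5 : q * R = (r : ℂ)⁻¹ • q := by rw [← hcomm.eq, h2]
        simp only [U, mul_add, mul_one, mul_smul_comm, neg_mul, smul_mul_assoc, h5, h2, ha,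
          smul_smul, ← neg_smul, ← add_smul]
        congr 1
        field_simp
        ring
      rw [h4, mul_assoc, Ring.mul_inverse_cancel _ hu, mul_one]
    simp only
    rw [← h1, sub_eq_add_neg, ← h3]
    noncomm_ring
  have hGcont : ContinuousOn (fun z => R * ((1 - q) * Ring.inverse (W z)))
      (Metric.closedBall (lam : ℂ) r) := by
    intro z hz
    obtain ⟨u, hu⟩ := hW z hz
    have h1 := NormedRing.inverse_continuousAt u
    rw [hu] at h1
    have h2 := h1.comp hWdiff.continuous.continuousAt
    exact (continuousAt_const.mul (continuousAt_const.mul h2)).continuousWithinAt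
  have hG : circleIntegral (fun z => R * ((1 - q) * Ring.inverse (W z))) lam r = 0 := by
    refine Complex.circleIntegral_eq_zero_of_differentiable_on_off_countable hr.le
      Set.countable_empty hGcont fun z hz => ?_
    have h1 : DifferentiableAt ℂ (Ring.inverse : (H →L[ℂ] H) → H →L[ℂ] H) (W z) :=
      differentiableAt_inverse (hW z (Metric.ball_subset_closedBall hz.1))
    have h2 : DifferentiableAt ℂ (fun z => Ring.inverse (W z)) z :=
      h1.comp z hWdiff.differentiableAt
    exact (h2.const_mul (1 - q)).const_mul R
  have hinvint : CircleIntegrable (fun z : ℂ => (z - lam)⁻¹ • q) lam r := by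
    refine ContinuousOn.circleIntegrable hr.le (ContinuousOn.smul (ContinuousOn.inv₀
      (by fun_prop) fun z hz => sub_ne_zero.2 (hsphere z hz).2) continuousOn_const)
  have hGint := ContinuousOn.circleIntegrable hr.le (hGcont.mono Metric.sphere_subset_closedBall)
  rw [rieszProjection, circleIntegral.integral_congr hr.le hresolv, ContinuousLinearMap.comp_smul,
    hL, circleIntegral.integral_congr hr.le hdec, circleIntegral.integral_sub hGint hinvint, hG,
    circleIntegral.integral_smul_const, circleIntegral.integral_sub_center_inv _ hr.ne', zero_sub,
    smul_neg, neg_smul, neg_neg, smul_smul, inv_mul_cancel₀ Complex.two_pi_I_ne_zero, one_smul]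

end RieszProjection

/-! ### Continuity and differentiability of the resolvent family. -/

section Family

variable {H : Type*} [NormedAddCommGroup H] [InnerProductSpace ℂ H] [CompleteSpace H]
  {𝔥 : Type*} [NormedAddCommGroup 𝔥] [InnerProductSpace ℂ 𝔥] [CompleteSpace 𝔥]
  {D : Type*} [NormedAddCommGroup D] [NormedSpace ℂ D]
  {A : H →ₗ.[ℂ] H} {ι : D →L[ℂ] H}

-- The resolvent at `a` is the one at `i` times the inverse of a bounded factor. This factor depends
-- continuously on `t` at `t₀` and is invertible there; units are open and inversion is continuous,
-- so continuity into `D` carries over.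
open Filter Topology in
theorem exists_continuous_resolvent_family [CompleteSpace D] (hι : Function.Injective ι)
    {E : ℝ → H →ₗ.[ℂ] H} {V : ℝ → H →L[ℂ] H} {s : Set ℝ} {t₀ : ℝ} (ht₀ : t₀ ∈ s)
    (hE : ∀ t ∈ s, IsSelfAdjoint (E t))
    (hdom : ∀ t ∈ s, (E t).domain ≤ LinearMap.range (ι : D →ₗ[ℂ] H))
    (hres : Tendsto (fun t => ‖resolventInto ι (E t) Complex.I - resolventInto ι (E t₀) Complex.I‖)
      (𝓝[s] t₀) (𝓝 0))
    (hV : ContinuousWithinAt V s t₀) {a : ℂ} (ha : a ∈ resolventSet (perturbed (E t₀) (V t₀))) :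
    ∃ ρ : ℝ → H →L[ℂ] D, ContinuousWithinAt ρ s t₀ ∧
      ∀ᶠ t in 𝓝[s] t₀, IsResolventInto ι (perturbed (E t) (V t)) a (ρ t) := by
  let σ : ℝ → H →L[ℂ] D := fun t => resolventInto ι (E t) Complex.I
  have hσ : ∀ t ∈ s, IsResolventInto ι (E t) Complex.I (σ t) := by
    intro t ht
    obtain ⟨ρ, hρ⟩ := exists_isResolventInto_I_of_domain_le hι (hE t ht) (hdom t ht)
    have : σ t = ρ := hρ.resolventInto_eq hι
    rwa [this]
  have hσc : ContinuousWithinAt σ s t₀ := tendsto_iff_norm_sub_tendsto_zero.2 hres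
  let U : ℝ → H →L[ℂ] H := fun t => 1 + (V t + (Complex.I - a) • 1) * (ι ∘L σ t)
  have hUc : ContinuousWithinAt U s t₀ :=
    continuousWithinAt_const.add ((hV.add continuousWithinAt_const).mul
      (continuousWithinAt_const.clm_comp hσc))
  have hU₀ : IsUnit (U t₀) := by
    obtain ⟨R, hR⟩ := ha
    exact (hσ t₀ ht₀).isUnit_of_perturbed hR
  refine ⟨fun t => σ t ∘L Ring.inverse (U t), hσc.clm_comp ?_, ?_⟩
  · obtain ⟨u, hu⟩ := hU₀
    have h1 := NormedRing.inverse_continuousAt u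
    rw [hu] at h1
    exact ContinuousAt.comp_continuousWithinAt h1 hUc
  · filter_upwards [hUc.eventually (Units.isOpen.mem_nhds hU₀), self_mem_nhdsWithin] with t ht hts
    exact (hσ t hts).perturb_inverse (V t) a ht

theorem adjoint_real_smul_comp {X Y Z : Type*} [NormedAddCommGroup X] [InnerProductSpace ℂ X]
    [CompleteSpace X] [NormedAddCommGroup Y] [InnerProductSpace ℂ Y] [CompleteSpace Y]
    [NormedAddCommGroup Z] [NormedSpace ℂ Z] (c : ℝ) (F : Z →L[ℂ] Y) (G : X →L[ℂ] Z) :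
    ContinuousLinearMap.adjoint ((c • F) ∘L G) = c • ContinuousLinearMap.adjoint (F ∘L G) := by
  have h : (c • F) ∘L G = (c : ℂ) • (F ∘L G) := by
    ext x
    simp
  rw [h, LinearIsometryEquiv.map_smulₛₗ, Complex.conj_ofReal]
  ext x
  simp

open Filter Topology in
theorem tendsto_clm_comp {α X Y Z : Type*} [NormedAddCommGroup X] [NormedSpace ℂ X]
    [NormedAddCommGroup Y] [NormedSpace ℂ Y] [NormedAddCommGroup Z] [NormedSpace ℂ Z]
    {l : Filter α} {f : α → Y →L[ℂ] Z} {g : α → X →L[ℂ] Y} {a : Y →L[ℂ] Z} {b : X →L[ℂ] Y}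
    (hf : Tendsto f l (𝓝 a)) (hg : Tendsto g l (𝓝 b)) :
    Tendsto (fun t => f t ∘L g t) l (𝓝 (a ∘L b)) :=
  (isBoundedBilinearMap_comp (𝕜 := ℂ).continuous.tendsto (a, b)).comp (hf.prodMk_nhds hg)

open Filter Topology in
/-- Differentiability at `t₀` of the resolvent of `E t + V t` in `B(H)`. -/
theorem hasParamDeriv_resolvent (hA : Dense (A.domain : Set H)) (hι : IsTraceDomain A ι)
    {T : ℝ → D →L[ℂ] WithLp 2 (𝔥 × 𝔥)}
    {Q : ℝ → WithLp 2 (𝔥 × 𝔥) →L[ℂ] WithLp 2 (𝔥 × 𝔥)}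
    {E : ℝ → H →ₗ.[ℂ] H} {V : ℝ → H →L[ℂ] H}
    (hfam : ∀ t ∈ Set.Icc (0 : ℝ) 1, IsAdmissible A ι (T t) (Q t) (E t) (V t))
    {t₀ : ℝ} (ht₀ : t₀ ∈ Set.Icc (0 : ℝ) 1)
    {dT : D →L[ℂ] WithLp 2 (𝔥 × 𝔥)} (hT : HasParamDeriv T dT t₀)
    {dQ : WithLp 2 (𝔥 × 𝔥) →L[ℂ] WithLp 2 (𝔥 × 𝔥)} (hQ : HasParamDeriv Q dQ t₀)
    {dV : H →L[ℂ] H} (hV : HasParamDeriv V dV t₀) {a : ℝ} {ρ : ℝ → H →L[ℂ] D}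
    (hρc : ContinuousWithinAt ρ (Set.Icc 0 1) t₀)
    (hρ : ∀ᶠ t in 𝓝[Set.Icc 0 1] t₀, IsResolventInto ι (perturbed (E t) (V t)) a (ρ t)) :
    HasParamDeriv (fun t => ι ∘L ρ t)
      (ContinuousLinearMap.adjoint (dQ ∘L T t₀ ∘L ρ t₀) ∘L (symplecticJ 𝔥 ∘L T t₀ ∘L ρ t₀)
        - ContinuousLinearMap.adjoint (dT ∘L ρ t₀) ∘L (symplecticJ 𝔥 ∘L T t₀ ∘L ρ t₀)
        - ContinuousLinearMap.adjoint (ι ∘L ρ t₀) ∘L dV ∘L (ι ∘L ρ t₀)) t₀ := by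
  have hρ₀ := hρ.self_of_nhdsWithin ht₀
  rw [HasParamDeriv, hasDerivWithinAt_iff_tendsto_slope]
  have hle : 𝓝[Set.Icc 0 1 \ {t₀}] t₀ ≤ 𝓝[Set.Icc 0 1] t₀ := nhdsWithin_mono _ Set.sdiff_subset
  have hT' := hasDerivWithinAt_iff_tendsto_slope.1 hT
  have hQ' := hasDerivWithinAt_iff_tendsto_slope.1 hQ
  have hV' := hasDerivWithinAt_iff_tendsto_slope.1 hV
  have hTc : Tendsto T (𝓝[Set.Icc 0 1 \ {t₀}] t₀) (𝓝 (T t₀)) :=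
    (HasDerivWithinAt.continuousWithinAt hT).mono_left hle
  have hρc' : Tendsto ρ (𝓝[Set.Icc 0 1 \ {t₀}] t₀) (𝓝 (ρ t₀)) := hρc.mono_left hle
  have hTρ : Tendsto (fun t => symplecticJ 𝔥 ∘L T t ∘L ρ t) (𝓝[Set.Icc 0 1 \ {t₀}] t₀)
      (𝓝 (symplecticJ 𝔥 ∘L T t₀ ∘L ρ t₀)) :=
    tendsto_clm_comp tendsto_const_nhds (tendsto_clm_comp hTc hρc')
  have hadj : Continuous (ContinuousLinearMap.adjoint : (H →L[ℂ] WithLp 2 (𝔥 × 𝔥)) ≃ₗᵢ⋆[ℂ] _) :=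
    LinearIsometryEquiv.continuous _
  have h1 := tendsto_clm_comp ((hadj.tendsto _).comp (tendsto_clm_comp hQ'
    (tendsto_const_nhds (x := T t₀ ∘L ρ t₀)))) hTρ
  have h2 := tendsto_clm_comp ((hadj.tendsto _).comp (tendsto_clm_comp hT'
    (tendsto_const_nhds (x := ρ t₀)))) hTρ
  have h3 := tendsto_clm_comp
    (tendsto_const_nhds (x := ContinuousLinearMap.adjoint (ι ∘L ρ t₀)))
    (tendsto_clm_comp hV' (tendsto_clm_comp (tendsto_const_nhds (x := ι)) hρc'))
  have hlim := (h1.sub h2).sub h3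
  -- By the difference formula, the difference quotient is this expression with slopes in place of
  -- derivatives; the undifferenced factors only have to converge.
  refine hlim.congr' ?_
  filter_upwards [hle hρ, self_mem_nhdsWithin] with t ht hts
  have hsub := resolvent_sub_eq hA hι (hfam t₀ ht₀) (hfam t hts.1) hρ₀ ht
  simp only [Function.comp_apply, slope_def_module]
  rw [hsub, adjoint_real_smul_comp, adjoint_real_smul_comp]
  ext x
  simp [smul_sub]

end Family

/-! ### Inversion of the disc and the isolated eigenvalue. -/

section IsolatedEigenvalue

/-- With `w = z - (lam - r)`, the condition `|w - r| < r` reads `|w|² < 2 r Re w`, which is `Re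
(1/w) > 1/(2r)`. -/
theorem lt_re_inv_of_mem_ball {lam r : ℝ} (hr : 0 < r) {z : ℂ}
    (hz : z ∈ Metric.ball (lam : ℂ) r) :
    z ≠ ((lam - r : ℝ) : ℂ) ∧ 1 / (2 * r) < ((z - ((lam - r : ℝ) : ℂ))⁻¹).re := by
  rw [Metric.mem_ball, dist_eq_norm] at hz
  obtain ⟨w, hw⟩ : ∃ w, w = z - ((lam - r : ℝ) : ℂ) := ⟨_, rfl⟩
  have hzw : z - lam = w - r := by rw [hw]; push_cast; ring
  rw [hzw] at hz
  have h1 : Complex.normSq (w - r) < r ^ 2 := by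
    rw [Complex.normSq_eq_norm_sq]
    exact pow_lt_pow_left₀ hz (norm_nonneg _) two_ne_zero
  have h2 : Complex.normSq (w - r) = Complex.normSq w - 2 * r * w.re + r ^ 2 := by
    simp only [Complex.normSq_apply, Complex.sub_re, Complex.sub_im, Complex.ofReal_re,
      Complex.ofReal_im]
    ring
  have h3 : Complex.normSq w < 2 * r * w.re := by linarith
  have hw0 : w ≠ 0 := by
    rintro rfl
    simp at h3
  rw [← hw]
  refine ⟨fun h => hw0 (by rw [hw, h, sub_self]), ?_⟩
  rw [Complex.inv_re, div_lt_div_iff₀ (by positivity) (Complex.normSq_pos.2 hw0)]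
  linarith

variable {H : Type*} [NormedAddCommGroup H] [InnerProductSpace ℂ H]

theorem IsUpperEigenvalueList.isEigenvalueList {S : H →ₗ.[ℂ] H} {R : H →L[ℂ] H} {lam r : ℝ}
    (hr : 0 < r)
    (hR : IsResolventInto (ContinuousLinearMap.id ℂ H) S ((lam - r : ℝ) : ℂ) R) {m : ℕ}
    {κ : Fin m → ℝ} (hκ : IsUpperEigenvalueList R (1 / (2 * r)) κ) :
    IsEigenvalueList S (Metric.ball (lam : ℂ) r) fun j => lam - r + (κ j)⁻¹ := by
  have hpos : ∀ j, 0 < κ j := fun j => lt_trans (by positivity) (hκ.lt j)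
  have hiff : ∀ z ∈ Metric.ball (lam : ℂ) r, ∀ j,
      ((lam - r + (κ j)⁻¹ : ℝ) : ℂ) = z ↔ (κ j : ℂ) = (z - ((lam - r : ℝ) : ℂ))⁻¹ := by
    intro z hz j
    have h1 : ((lam - r + (κ j)⁻¹ : ℝ) : ℂ) = ((lam - r : ℝ) : ℂ) + (κ j : ℂ)⁻¹ := by push_cast; ring
    rw [h1, add_comm, ← eq_sub_iff_add_eq, inv_eq_iff_eq_inv]
  refine ⟨fun j => ?_, fun z hz => ?_, fun z hz => ?_⟩
  · rw [Metric.mem_ball, dist_eq_norm, ← Complex.ofReal_sub, Complex.norm_real, Real.norm_eq_abs,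
      abs_sub_lt_iff]
    have h1 : (κ j)⁻¹ < 2 * r := by
      have h2 := hκ.lt j
      rw [one_div] at h2
      exact inv_lt_of_inv_lt₀ (by positivity) h2
    have h2 : 0 < (κ j)⁻¹ := inv_pos.2 (hpos j)
    constructor <;> linarith
  · obtain ⟨h1, h2⟩ := lt_re_inv_of_mem_ball hr hz
    rw [hR.mem_spec_iff h1, hκ.mem_spectrum_iff _ h2]
    exact exists_congr fun j => (hiff z hz j).symm
  · obtain ⟨h1, h2⟩ := lt_re_inv_of_mem_ball hr hz
    have h3 : eigenspace S z
        = Module.End.eigenspace (R : H →ₗ[ℂ] H) (z - ((lam - r : ℝ) : ℂ))⁻¹ := by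
      ext x
      rw [hR.mem_eigenspace_iff h1, Module.End.mem_eigenspace_iff]
      rfl
    rw [h3, ← hκ.card_eq _ h2]
    exact Nat.card_congr (Equiv.subtypeEquivRight fun j => hiff z hz j)

theorem sum_inner_smul_eq_of_orthonormal {M : Submodule ℂ H} {m : ℕ} (hm : 0 < m)
    (hM : Module.finrank ℂ M = m) {e : Fin m → H} (he : Orthonormal ℂ e) (heM : ∀ j, e j ∈ M)
    {x : H} (hx : x ∈ M) : ∑ j, inner ℂ (e j) x • e j = x := by
  have : FiniteDimensional ℂ M := FiniteDimensional.of_finrank_pos (by rw [hM]; exact hm)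
  have hle : Submodule.span ℂ (Set.range e) ≤ M := by
    rw [Submodule.span_le]
    rintro _ ⟨j, rfl⟩
    exact heM j
  have heq := Submodule.eq_of_le_of_finrank_eq hle (by
    rw [finrank_span_eq_card he.linearIndependent, hM, Fintype.card_fin])
  rw [← heq, Submodule.mem_span_range_iff_exists_fun] at hx
  obtain ⟨c, rfl⟩ := hx
  exact Finset.sum_congr rfl fun j _ => by rw [he.inner_right_fintype]

variable [CompleteSpace H]

/-- Spectral points of `R` in `[1/(2r), ∞)` come from spectrum of `S` in the closed disc, so the
only one is `1/r`. The endpoint `1/(2r)` corresponds to `lam + r` on the circle and is therefore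
excluded. Thus `R` is scalar on `ran q`, which gives semisimplicity. -/
theorem exists_projection_of_isolated {S : H →ₗ.[ℂ] H} {R : H →L[ℂ] H} {lam r : ℝ} (hr : 0 < r)
    (hR : IsResolventInto (ContinuousLinearMap.id ℂ H) S ((lam - r : ℝ) : ℂ) R)
    (hRs : IsSelfAdjoint R) (hisol : Metric.closedBall (lam : ℂ) r ∩ spec S = {(lam : ℂ)}) :
    ∃ q c, c < 1 / (2 * r) ∧ 1 / (2 * r) ∉ spectrum ℝ R ∧
      IsUpperSpectralProjection R q (1 / (2 * r)) c ∧ R * q = (r : ℂ)⁻¹ • q ∧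
      ∀ x, x ∈ eigenspace S lam ↔ q x = x := by
  have hspec : ∀ s ∈ spectrum ℝ R, 1 / (2 * r) ≤ s → s = r⁻¹ := by
    intro s hs hbs
    have hs0 : 0 < s := lt_of_lt_of_le (by positivity) hbs
    have hs' : (s : ℂ) ∈ spectrum ℂ R := (spectrum.algebraMap_mem_iff ℂ).2 hs
    let z : ℂ := ((lam - r + s⁻¹ : ℝ) : ℂ)
    have hza : z - ((lam - r : ℝ) : ℂ) = (s : ℂ)⁻¹ := by simp only [z]; push_cast; ring
    have hzne : z ≠ ((lam - r : ℝ) : ℂ) := by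
      rw [← sub_ne_zero, hza]
      exact inv_ne_zero (by exact_mod_cast hs0.ne')
    have hzs : z ∈ spec S := by
      rw [hR.mem_spec_iff hzne, hza, inv_inv]
      exact hs'
    have hzb : z ∈ Metric.closedBall (lam : ℂ) r := by
      rw [Metric.mem_closedBall, dist_eq_norm, ← Complex.ofReal_sub, Complex.norm_real,
        Real.norm_eq_abs, abs_sub_le_iff]
      have h1 : s⁻¹ ≤ 2 * r := by
        rw [one_div] at hbs
        exact inv_le_of_inv_le₀ (by positivity) hbs
      have h2 : 0 < s⁻¹ := inv_pos.2 hs0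
      constructor <;> linarith
    have hzl : z = lam := by
      have : z ∈ ({(lam : ℂ)} : Set ℂ) := hisol ▸ ⟨hzb, hzs⟩
      exact this
    have h3 : lam - r + s⁻¹ = lam := Complex.ofReal_injective hzl
    rw [← inv_inv s]
    congr 1
    linarith
  have hlt : 1 / (2 * r) < r⁻¹ := by
    rw [one_div]
    exact inv_strictAnti₀ hr (by linarith)
  have hb : 1 / (2 * r) ∉ spectrum ℝ R := fun h => hlt.ne (hspec _ h le_rfl)
  obtain ⟨q, c, hcb, hq⟩ := exists_isUpperSpectralProjection hRs hb
  have hRq : R * q = (r : ℂ)⁻¹ • q := by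
    have h1 := (hq.aeval_mul_eq_zero_iff (Polynomial.X - Polynomial.C r⁻¹)).2 fun s hs hbs => by
      rw [Polynomial.eval_sub, Polynomial.eval_X, Polynomial.eval_C, hspec s hs hbs.le, sub_self]
    rw [map_sub, Polynomial.aeval_X, Polynomial.aeval_C, sub_mul, sub_eq_zero] at h1
    rw [h1, Algebra.algebraMap_eq_smul_one, smul_one_mul]
    ext x
    rw [smul_apply, smul_apply, ← Complex.ofReal_inv, Complex.coe_smul]
  have hlam : (lam : ℂ) - ((lam - r : ℝ) : ℂ) = r := by push_cast; ring
  have hlne : (lam : ℂ) ≠ ((lam - r : ℝ) : ℂ) := by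
    rw [← sub_ne_zero, hlam]
    exact_mod_cast hr.ne'
  refine ⟨q, c, hcb, hb, hq, hRq, fun x => ?_⟩
  rw [hR.mem_eigenspace_iff hlne, hlam]
  constructor
  · refine hq.apply_eq_self hcb ?_
    rw [← Complex.ofReal_inv, Complex.ofReal_re]
    exact hlt
  · intro hx
    have h1 := congrArg (fun A : H →L[ℂ] H => A x) hRq
    simp only [mul_apply_eq_comp, smul_apply, hx] at h1
    exact h1

end IsolatedEigenvalue

/-! ### The sesquilinear form of the first-order operator. -/

section FirstOrderOperator

variable {H : Type*} [NormedAddCommGroup H] [InnerProductSpace ℂ H] [CompleteSpace H]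
  {𝔥 : Type*} [NormedAddCommGroup 𝔥] [InnerProductSpace ℂ 𝔥] [CompleteSpace 𝔥]
  {D : Type*} [NormedAddCommGroup D] [NormedSpace ℂ D]

theorem inner_firstOrderOperator {ι : D →L[ℂ] H} {P : H →L[ℂ] D}
    (hP : IsSelfAdjoint (ι ∘L P)) (T dT : D →L[ℂ] WithLp 2 (𝔥 × 𝔥))
    (dQ : WithLp 2 (𝔥 × 𝔥) →L[ℂ] WithLp 2 (𝔥 × 𝔥)) (dV : H →L[ℂ] H) (x y : H) :
    inner ℂ x (firstOrderOperator ι P T dT dQ dV y) =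
      inner ℂ (ι (P x)) (dV (ι (P y)))
        - inner ℂ (T (P x)) (dQ (symplecticJ 𝔥 (T (P y))))
        - inner ℂ (T (P x)) (symplecticJ 𝔥 (dT (P y))) := by
  have h1 : inner ℂ (ι (P x)) (dV (ι (P y))) = inner ℂ x (ι (P (dV (ι (P y))))) :=
    hP.isSymmetric x _
  rw [h1]
  simp only [firstOrderOperator, sub_apply, ContinuousLinearMap.comp_apply, inner_sub_right,
    ContinuousLinearMap.adjoint_inner_right]

end FirstOrderOperator

end Hadamard

end

/-! ### The Hadamard-type formula. -/

theorem mainTheorem4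
    {H : Type*} [NormedAddCommGroup H] [InnerProductSpace ℂ H] [CompleteSpace H]
    [TopologicalSpace.SeparableSpace H]
    {𝔥 : Type*} [NormedAddCommGroup 𝔥] [InnerProductSpace ℂ 𝔥] [CompleteSpace 𝔥]
    [TopologicalSpace.SeparableSpace 𝔥]
    {D : Type*} [NormedAddCommGroup D] [NormedSpace ℂ D] [CompleteSpace D]
    -- the symmetric operator and the domain of the traces
    (A : H →ₗ.[ℂ] H) (hA : Hadamard.IsSymmetricOperator A)
    (ι : D →L[ℂ] H) (hι : Hadamard.IsTraceDomain A ι)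
    -- the families of traces, projections, self-adjoint extensions and potentials
    (T : ℝ → D →L[ℂ] WithLp 2 (𝔥 × 𝔥))
    (Q : ℝ → WithLp 2 (𝔥 × 𝔥) →L[ℂ] WithLp 2 (𝔥 × 𝔥))
    (E : ℝ → H →ₗ.[ℂ] H) (V : ℝ → H →L[ℂ] H)
    (hfam : ∀ t ∈ Set.Icc (0 : ℝ) 1, Hadamard.IsAdmissible A ι (T t) (Q t) (E t) (V t))
    (t₀ : ℝ) (ht₀ : t₀ ∈ Set.Icc (0 : ℝ) 1)
    -- continuity at `t₀` of the resolvents of `E t` as operators from `H` to `D`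
    (hres : Filter.Tendsto
      (fun t => ‖Hadamard.resolventInto ι (E t) Complex.I
        - Hadamard.resolventInto ι (E t₀) Complex.I‖)
      (nhdsWithin t₀ (Set.Icc 0 1)) (nhds 0))
    -- differentiability at `t₀`
    (dT : D →L[ℂ] WithLp 2 (𝔥 × 𝔥)) (hT : Hadamard.HasParamDeriv T dT t₀)
    (dQ : WithLp 2 (𝔥 × 𝔥) →L[ℂ] WithLp 2 (𝔥 × 𝔥))
    (hQ : Hadamard.HasParamDeriv Q dQ t₀)
    (dV : H →L[ℂ] H) (hV : Hadamard.HasParamDeriv V dV t₀)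
    -- the isolated eigenvalue of multiplicity `m`
    (lam : ℝ) (m : ℕ) (hm : 0 < m)
    (hmult : Module.finrank ℂ
      (Hadamard.eigenspace (Hadamard.perturbed (E t₀) (V t₀)) lam) = m)
    (r : ℝ) (hr : 0 < r)
    (hisol : Metric.closedBall (lam : ℂ) r ∩
      Hadamard.spec (Hadamard.perturbed (E t₀) (V t₀)) = {(lam : ℂ)}) :
    let N : Submodule ℂ H := Hadamard.eigenspace (Hadamard.perturbed (E t₀) (V t₀)) lam
    let P : H →L[ℂ] D :=
      Hadamard.rieszProjection ι (Hadamard.perturbed (E t₀) (V t₀)) lam r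
    let T₁ : H →L[ℂ] H := Hadamard.firstOrderOperator ι P (T t₀) dT dQ dV
    LinearMap.range ((ι ∘L P : H →L[ℂ] H) : H →ₗ[ℂ] H) = N ∧
    (∃ (u : Fin m → D) (μ : Fin m → ℝ), Hadamard.IsEigenbasisIn ι N T₁ u μ) ∧
    ∀ (u : Fin m → D) (μ : Fin m → ℝ), Hadamard.IsEigenbasisIn ι N T₁ u μ →
      ∃ Λ : Fin m → ℝ → ℝ,
        (∀ᶠ t in nhdsWithin t₀ (Set.Icc 0 1),
          Hadamard.IsEigenvalueList (Hadamard.perturbed (E t) (V t))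
            (Metric.ball (lam : ℂ) r) (fun j => Λ j t)) ∧
        ∀ j : Fin m,
          (fun t => Λ j t - (lam + μ j * (t - t₀)))
            =o[nhdsWithin t₀ (Set.Icc 0 1)] (fun t => t - t₀) ∧
          ∃ dΛ : ℝ, HasDerivWithinAt (Λ j) dΛ (Set.Icc 0 1) t₀ ∧
            (dΛ : ℂ) = inner ℂ (ι (u j)) (dV (ι (u j)))
              + Hadamard.symplecticForm (dQ (T t₀ (u j))) (T t₀ (u j))
              + Hadamard.symplecticForm (T t₀ (u j)) (dT (u j)) := by
  intro N P T₁
  set H₀ := Hadamard.perturbed (E t₀) (V t₀) with hH₀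
  have hreg : ∀ z ∈ Metric.closedBall (lam : ℂ) r, z ≠ lam → z ∈ Hadamard.resolventSet H₀ := by
    intro z hz hzl
    by_contra h
    have : z ∈ ({(lam : ℂ)} : Set ℂ) := hisol ▸ ⟨hz, h⟩
    exact hzl this
  have ha : ((lam - r : ℝ) : ℂ) ∈ Hadamard.resolventSet H₀ := by
    have h1 : ((lam - r : ℝ) : ℂ) - lam = -(r : ℂ) := by push_cast; ring
    refine hreg _ ?_ ?_
    · rw [Metric.mem_closedBall, dist_eq_norm, h1, norm_neg, Complex.norm_real, Real.norm_eq_abs,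
        abs_of_pos hr]
    · rw [← sub_ne_zero, h1]
      exact neg_ne_zero.2 (by exact_mod_cast hr.ne')
  obtain ⟨ρ, hρc, hρ⟩ := Hadamard.exists_continuous_resolvent_family hι.injective ht₀
    (fun t ht => (hfam t ht).selfAdjoint) (fun t ht => (hfam t ht).domain_le) hres
    (HasDerivWithinAt.continuousWithinAt hV) ha
  have hρ₀ : Hadamard.IsResolventInto ι H₀ ((lam - r : ℝ) : ℂ) (ρ t₀) := hρ.self_of_nhdsWithin ht₀
  have hRsa : ∀ᶠ t in nhdsWithin t₀ (Set.Icc 0 1), IsSelfAdjoint (ι ∘L ρ t) := by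
    filter_upwards [hρ, self_mem_nhdsWithin] with t h1 h2
    exact h1.toHilbert.isSelfAdjoint (Hadamard.perturbed_isFormalAdjoint
      (Hadamard.isFormalAdjoint_of_isSelfAdjoint (hfam t h2).selfAdjoint) (hfam t h2).potential)
  have hRsa₀ : IsSelfAdjoint (ι ∘L ρ t₀) := hRsa.self_of_nhdsWithin ht₀
  obtain ⟨q, c, hcb, hb, hq, hRq, hqN⟩ :=
    Hadamard.exists_projection_of_isolated hr hρ₀.toHilbert hRsa₀ hisol
  have hr0 : (r : ℂ) ≠ 0 := by exact_mod_cast hr.ne'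
  have hιP : ι ∘L P = q := by
    refine Hadamard.comp_rieszProjection hι.injective hr hρ₀
      hq.isStarProjection.isIdempotentElem hq.commute ?_ hreg
      (Hadamard.isUnit_one_sub_smul_of_upper hq hr (by field_simp) hcb)
    rw [hRq, smul_smul, mul_inv_cancel₀ hr0, one_smul]
  have hιPx : ∀ x, ι (P x) = q x := fun x => congrArg (fun B : H →L[ℂ] H => B x) hιP
  have hqq : ∀ x, q (q x) = q x := fun x =>
    congrArg (fun B : H →L[ℂ] H => B x) hq.isStarProjection.isIdempotentElem.eq
  have hqs : ∀ x y, inner ℂ (q x) y = inner ℂ x (q y) :=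
    hq.isStarProjection.isSelfAdjoint.isSymmetric
  have hPu : ∀ u : D, ι u ∈ N → P (ι u) = u := fun u hu =>
    hι.injective (by rw [hιPx]; exact (hqN _).1 hu)
  have hPq : ∀ x, P (q x) = P x := fun x => hι.injective (by rw [hιPx, hιPx, hqq])
  have hT₁ : ∀ x y, inner ℂ x (T₁ y) = inner ℂ (ι (P x)) (dV (ι (P y)))
        - inner ℂ (T t₀ (P x)) (dQ (Hadamard.symplecticJ 𝔥 (T t₀ (P y))))
        - inner ℂ (T t₀ (P x)) (Hadamard.symplecticJ 𝔥 (dT (P y))) :=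
    Hadamard.inner_firstOrderOperator (hιP ▸ hq.isStarProjection.isSelfAdjoint) _ _ _ _
  have hdV := Hadamard.inner_deriv_comm_of_isSelfAdjoint ht₀ hV fun t ht => (hfam t ht).potential
  have hdQ := Hadamard.inner_deriv_comm_of_isSelfAdjoint ht₀ hQ
    fun t ht => (hfam t ht).projection.isSelfAdjoint
  have hJQ := Hadamard.projection_deriv_symplecticJ ht₀ (fun t ht => (hfam t ht).projection)
    (fun t ht => (hfam t ht).lagrangian) hQ
  have hgreen := Hadamard.symplecticForm_deriv_add hι ht₀ (fun t ht => (hfam t ht).trace) hT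
  refine ⟨?_, ?_, ?_⟩
  · rw [hιP]
    ext x
    refine Iff.trans ?_ (hqN x).symm
    constructor
    · rintro ⟨y, rfl⟩
      exact hqq y
    · intro h
      exact ⟨x, h⟩
  -- The `Q̇ J` term is symmetric because `Q̇` is symmetric and anticommutes with the skew `J`; the
  -- `J Ṫ` term is symmetric by the differentiated Green identity.
  · have hsymm : (T₁ : H →ₗ[ℂ] H).IsSymmetric := by
      intro x y
      have h1 : inner ℂ (T₁ x) y = (starRingEnd ℂ) (inner ℂ y (T₁ x)) := (inner_conj_symm _ _).symm
      refine h1.trans ?_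
      rw [ContinuousLinearMap.coe_coe, hT₁, hT₁, map_sub, map_sub, inner_conj_symm, inner_conj_symm,
        inner_conj_symm, hdV, hdQ, Hadamard.inner_symplecticJ_left,
        Hadamard.inner_symplecticJ_left, hJQ, inner_neg_right]
      linear_combination hgreen (P y) (P x)
    have hinv : ∀ x ∈ N, (T₁ : H →ₗ[ℂ] H) x ∈ N := by
      intro x _
      refine (hqN _).2 (ext_inner_left ℂ fun y => ?_)
      rw [← hqs, ContinuousLinearMap.coe_coe, hT₁, hT₁, hPq]
    have hfin : FiniteDimensional ℂ N := FiniteDimensional.of_finrank_pos (by rw [hmult]; exact hm)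
    obtain ⟨f, μ, -, hf, hfN, hfμ, -⟩ := Hadamard.exists_orthonormal_eigenbasis hsymm hmult hinv
    have hιf : ∀ j, ι (P (f j)) = f j := fun j => (hιPx _).trans ((hqN _).1 (hfN j))
    refine ⟨fun j => P (f j), μ, ⟨?_, fun j => ?_, fun j => ?_⟩⟩
    · simpa only [hιf] using hf
    · rw [hιf]
      exact hfN j
    · rw [hιf]
      exact hfμ j
  · intro u μ hu
    have hPuj : ∀ j, P (ι (u j)) = u j := fun j => hPu _ (hu.mem j)
    have hqe : ∀ x, ∑ j, inner ℂ (ι (u j)) x • ι (u j) = q x := by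
      intro x
      rw [← Hadamard.sum_inner_smul_eq_of_orthonormal hm hmult hu.orthonormal hu.mem
        ((hqN (q x)).2 (hqq x))]
      refine Finset.sum_congr rfl fun j _ => ?_
      rw [← hqs, (hqN _).1 (hu.mem j)]
    have hRe : ∀ j, ι (ρ t₀ (ι (u j))) = (r : ℂ)⁻¹ • ι (u j) := by
      intro j
      have h1 := congrArg (fun B : H →L[ℂ] H => B (ι (u j))) hRq
      simpa only [mul_apply_eq_comp, smul_apply, (hqN _).1 (hu.mem j),
        ContinuousLinearMap.comp_apply] using h1
    -- The eigenvalue relation is lifted to `D`, where the traces act.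
    have hρe : ∀ j, ρ t₀ (ι (u j)) = (r : ℂ)⁻¹ • u j := fun j =>
      hι.injective (by rw [hRe, map_smul])
    have hT₁e : ∀ i j, inner ℂ (ι (u i)) (T₁ (ι (u j))) = if i = j then (μ j : ℂ) else 0 := by
      intro i j
      rw [hu.eigen, inner_smul_right, orthonormal_iff_ite.1 hu.orthonormal i j]
      simp
    have hderiv := Hadamard.hasParamDeriv_resolvent hA.dense hι hfam ht₀ hT hQ hV hρc hρ
    -- Each of the two resolvent factors contributes `1/r`, so the compressed derivative is `-r⁻²
    -- T⁽¹⁾`; the differentiated Green identity moves `Ṫ` from the left to the right argument.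
    have hK' : ∀ i j, inner ℂ (ι (u i))
        ((ContinuousLinearMap.adjoint (dQ ∘L T t₀ ∘L ρ t₀)
            ∘L (Hadamard.symplecticJ 𝔥 ∘L T t₀ ∘L ρ t₀)
          - ContinuousLinearMap.adjoint (dT ∘L ρ t₀) ∘L (Hadamard.symplecticJ 𝔥 ∘L T t₀ ∘L ρ t₀)
          - ContinuousLinearMap.adjoint (ι ∘L ρ t₀) ∘L dV ∘L (ι ∘L ρ t₀)) (ι (u j)))
        = if i = j then ((-μ j / r ^ 2 : ℝ) : ℂ) else 0 := by
      intro i j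
      have h1 : (if i = j then ((-μ j / r ^ 2 : ℝ) : ℂ) else 0)
          = -((r : ℂ)⁻¹ * (r : ℂ)⁻¹ * inner ℂ (ι (u i)) (T₁ (ι (u j)))) := by
        rw [hT₁e]
        split_ifs
        · push_cast
          field_simp
        · simp
      rw [h1, hT₁, hPuj, hPuj]
      simp only [sub_apply, ContinuousLinearMap.comp_apply, inner_sub_right,
        ContinuousLinearMap.adjoint_inner_right, hρe, map_smul, inner_smul_left, inner_smul_right,
        hdQ, map_inv₀, Complex.conj_ofReal]
      linear_combination -((r : ℂ)⁻¹ * (r : ℂ)⁻¹ * hgreen (u j) (u i))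
    have hlt : 1 / (2 * r) < r⁻¹ := by
      rw [one_div]
      exact inv_strictAnti₀ hr (by linarith)
    obtain ⟨κ, hκ, hκd⟩ := hq.exists_eigenvalue_branches ht₀ hRsa hderiv hcb hb hu.orthonormal hqe
      hlt (by simpa using hRe) hK'
    have hΛ₀ : ∀ j, lam - r + (κ j t₀)⁻¹ = lam := fun j => by
      rw [(hκd j).1, inv_inv]
      ring
    have hΛd : ∀ j, HasDerivWithinAt (fun t => lam - r + (κ j t)⁻¹) (μ j) (Set.Icc 0 1) t₀ := by
      intro j
      have h0 : κ j t₀ ≠ 0 := by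
        rw [(hκd j).1]
        exact inv_ne_zero hr.ne'
      have h1 := ((hκd j).2.inv h0).const_add (lam - r)
      -- Inverting `κ j` at `1/r` cancels both the sign and the factor `r⁻²`.
      have h2 : -(-μ j / r ^ 2) / κ j t₀ ^ 2 = μ j := by
        rw [(hκd j).1]
        have := hr.ne'
        field_simp
      rw [h2] at h1
      exact h1
    refine ⟨fun j t => lam - r + (κ j t)⁻¹, ?_, fun j => ⟨?_, μ j, hΛd j, ?_⟩⟩
    · filter_upwards [hκ, hρ] with t h1 h2
      exact h1.isEigenvalueList hr h2.toHilbert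
    · have h1 := hasDerivWithinAt_iff_isLittleO.1 (hΛd j)
      refine h1.congr_left fun t => ?_
      rw [hΛ₀, smul_eq_mul]
      ring
    · have h1 := hT₁e j j
      rw [if_pos rfl, hT₁, hPuj] at h1
      rw [← h1, Hadamard.symplecticForm_eq_inner, Hadamard.symplecticForm_eq_inner, hJQ,
        inner_neg_right]
      linear_combination -hgreen (u j) (u j)
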